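/- **Definitions.** A function $u$ with values in $[-\infty,\infty)$ is subharmonic on an open set of $\mathbb C$ if it is upper semicontinuous and satisfies the sub-mean value inequality on every closed disc in that set. A set $F\subset\mathbb C$ is *polar* if there are an open set $U\supset F$ and a function $u$, subharmonic on $U$ and not identically $-\infty$ on any component of $U$, with $u=-\infty$ on $F$. Let $L(\mathbb C)$ be the set of subharmonic functions $u$ on $\mathbb C$ with $u(z)\le\log|z|+O(1)$ as $|z|\to\infty$. For $E\subset\mathbb C$ let $V_E(z)=\sup\{u(z):u\in L(\mathbb C),\ u\le 0\text{ on }E\}$ and $V_E^*(z)=\limsup_{\zeta\to z}V_E(\zeta)$. The logarithmic capacity of a compact set $K$ is $C(K)=\exp\bigl[-\inf_\nu\iint\log\frac1{|z-\zeta|}\,d\nu(z)\,d\nu(\zeta)\bigr]$, the infimum being over Borel probability measures $\nu$ on $K$; for a Borel set $E$, $C(E)=\sup\{C(K):K\subset E\text{ compact}\}$. Let $\mu$ be a finite measure on a compact set $K\subset\mathbb C$. A *carrier* of $\mu$ is a Borel set $E\subset K$ with $\mu(E)=\mu(K)$, and $\mu$ is *determining* for $K$ if $V_E^*=V_K^*$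 for every carrier $E$ of $\mu$. The pair $(K,\mu)$ has the *polynomial Bernstein–Markov property* if for every $\epsilon>0$ there is a constant $C$ such that for all $k\ge1$ and all complex polynomials $p$ of degree at most $k$, $$\sup_K|p|\le C(1+\epsilon)^k\,\|p\|_{L^2(\mu)}.$$ It has the *subharmonic Bernstein–Markov property* if for every $\epsilon>0$ there is a constant $C$ such that for all real $p\ge1$ and all $u\in L(\mathbb C)$, $$\bigl(\sup_K e^{u}\bigr)^p\le C(1+\epsilon)^p\int e^{pu}\,d\mu .$$ **Statement (Totik's example).** Let $K=[0,1]\subset\mathbb C$. There are numbers $\epsilon_n>0$, $n\ge1$, with the following properties. Put $$\mu=\sum_{n=1}^\infty\mu_n,\qquad \frac{d\mu_n}{dx}=\frac1{n^5}\sum_{k=1}^{n^3-1}\frac1{\epsilon_n}\,\chi_{[k/n^3-\epsilon_n,\;k/n^3+\epsilon_n]},\qquad E=\bigcup_{n\ge1}\ \bigcup_{k=1}^{n^3-1}\Bigl[\frac k{n^3}-\epsilon_n,\ \frac k{n^3}+\epsilon_n\Bigr],$$ where $dx$ is Lebesgue measure on $\mathbb R$. Then $C(E)<1/8$, $\mu$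 is a finite measure with support equal to $[0,1]$, $E$ is a carrier of $\mu$, and 1. $\mu(F)=0$ for every polar set $F$; 2. $(K,\mu)$ has the polynomial Bernstein–Markov property; 3. $\mu$ is not a determining measure for $K$; 4. $(K,\mu)$ does not have the subharmonic Bernstein–Markov property. In particular, the polynomial and the subharmonic Bernstein–Markov properties are not equivalent. -/

import Mathlib

open MeasureTheory Filter Topology Set

noncomputable section

namespace BernsteinMarkov

/-- Integral of an extended-real function, as the integral of the positive part minus the integral
of the negative part. It is used only where the integrand is bounded above or bounded below and the
measure is finite, so that the difference is never `∞ - ∞`. -/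
def erealIntegral {α : Type*} [MeasurableSpace α] (f : α → EReal) (ν : Measure α) : EReal :=
  ((∫⁻ x, (f x).toENNReal ∂ν : ENNReal) : EReal) - ((∫⁻ x, (-f x).toENNReal ∂ν : ENNReal) : EReal)

/-- `u : U → [-∞, ∞)` is subharmonic on the open set `U ⊆ ℂ`: it is upper semicontinuous and
satisfies the sub-mean value inequality on every closed disc contained in `U`. The constant `-∞`
is allowed. The values of `u` outside `U` play no role. -/
structure IsSubharmonicOn (u : ℂ → EReal) (U : Set ℂ) : Prop where
  ne_top : ∀ z ∈ U, u z ≠ ⊤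
  usc : UpperSemicontinuousOn u U
  submean : ∀ (z : ℂ) (r : ℝ), 0 < r → Metric.closedBall z r ⊆ U →
    u z ≤ (((2 * Real.pi)⁻¹ : ℝ) : EReal) *
      erealIntegral (fun θ : ℝ => u (circleMap z r θ)) (volume.restrict (Ioc 0 (2 * Real.pi)))

/-- `F` is polar: some `u`, subharmonic on an open neighbourhood `U` of `F` and not identically
`-∞` on any connected component of `U`, equals `-∞` on `F`. -/
def IsPolar (F : Set ℂ) : Prop :=
  ∃ (U : Set ℂ) (u : ℂ → EReal), IsOpen U ∧ F ⊆ U ∧ IsSubharmonicOn u U ∧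
    (∀ z ∈ U, ∃ w ∈ connectedComponentIn U z, u w ≠ ⊥) ∧ ∀ z ∈ F, u z = ⊥

/-- The class `L(ℂ)`: subharmonic functions on `ℂ` with `u z ≤ log |z| + O(1)` as `|z| → ∞`. -/
def lelongClass : Set (ℂ → EReal) :=
  {u | IsSubharmonicOn u univ ∧
    ∃ C : ℝ, ∀ᶠ z in cocompact ℂ, u z ≤ ((Real.log ‖z‖ + C : ℝ) : EReal)}

/-- The extremal function `V_E`, the upper envelope of all `u ∈ L(ℂ)` with `u ≤ 0` on `E`. -/
def extremalFun (E : Set ℂ) (z : ℂ) : EReal :=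
  ⨆ u ∈ {u : ℂ → EReal | u ∈ lelongClass ∧ ∀ w ∈ E, u w ≤ 0}, u z

/-- The upper semicontinuous regularization `V_E^*`. -/
def extremalFunReg (E : Set ℂ) (z : ℂ) : EReal :=
  limsup (extremalFun E) (𝓝 z)

/-- A carrier of `μ` is a Borel subset of `K` of full `μ`-measure. -/
def IsCarrier (K : Set ℂ) (μ : Measure ℂ) (E : Set ℂ) : Prop :=
  MeasurableSet E ∧ E ⊆ K ∧ μ E = μ K

/-- `μ` is determining for `K`: every carrier `E` of `μ` has `V_E^* = V_K^*`. -/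
def IsDetermining (K : Set ℂ) (μ : Measure ℂ) : Prop :=
  ∀ E : Set ℂ, IsCarrier K μ E → extremalFunReg E = extremalFunReg K

/-- The (polynomial) Bernstein–Markov property of `(K, μ)`, for a measure `μ` carried by `K`. -/
def PolynomialBM (K : Set ℂ) (μ : Measure ℂ) : Prop :=
  ∀ ε : ℝ, 0 < ε → ∃ C : ℝ, ∀ k : ℕ, 1 ≤ k → ∀ p : Polynomial ℂ, p.natDegree ≤ k →
    (⨆ z ∈ K, ‖p.eval z‖ₑ) ≤
      ENNReal.ofReal (C * (1 + ε) ^ k) * eLpNorm (fun z => p.eval z) 2 μ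

/-- The Bernstein–Markov property of `(K, μ)` for subharmonic functions, for a measure `μ` carried
by `K`: `(sup_K e^u)^p ≤ C (1 + ε)^p ∫ e^{pu} dμ` for all real `p ≥ 1` and all `u ∈ L(ℂ)`. -/
def SubharmonicBM (K : Set ℂ) (μ : Measure ℂ) : Prop :=
  ∀ ε : ℝ, 0 < ε → ∃ C : ℝ, ∀ p : ℝ, 1 ≤ p → ∀ u ∈ lelongClass,
    (⨆ z ∈ K, EReal.exp (u z)) ^ p ≤
      ENNReal.ofReal (C * (1 + ε) ^ p) * ∫⁻ z, EReal.exp (u z) ^ p ∂μ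

/-- The logarithmic energy `∬ log (1 / |z - w|) dν(z) dν(w)`; the kernel is `+∞` for `z = w`. -/
def logEnergy (ν : Measure ℂ) : EReal :=
  erealIntegral (fun q : ℂ × ℂ => -ENNReal.log (edist q.1 q.2)) (ν.prod ν)

/-- The logarithmic capacity `exp (-inf I(ν))` of a compact set `K`, where `ν` runs through the
Borel probability measures on `K`. -/
def compactLogCapacity (K : Set ℂ) : ENNReal :=
  EReal.exp (-⨅ ν ∈ {ν : Measure ℂ | IsProbabilityMeasure ν ∧ ν Kᶜ = 0}, logEnergy ν)

/-- The (inner) logarithmic capacity of a Borel set. -/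
def logCapacity (E : Set ℂ) : ENNReal :=
  ⨆ K ∈ {K : Set ℂ | IsCompact K ∧ K ⊆ E}, compactLogCapacity K

/-- The interval `[0, 1]` as a subset of `ℂ`. -/
def unitSegment : Set ℂ := (fun x : ℝ => (x : ℂ)) '' Icc 0 1

/-- The interval `[k / n³ - ε, k / n³ + ε]`. -/
def smallInterval (ε : ℝ) (n k : ℕ) : Set ℝ :=
  Icc ((k : ℝ) / (n : ℝ) ^ 3 - ε) ((k : ℝ) / (n : ℝ) ^ 3 + ε)

/-- The measure on `ℝ` with Lebesgue density
`n⁻⁵ ∑_{k=1}^{n³-1} ε⁻¹ χ_{[k / n³ - ε, k / n³ + ε]}`. -/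
def spreadMeasure (ε : ℝ) (n : ℕ) : Measure ℝ :=
  volume.withDensity fun x => ENNReal.ofReal
    (1 / (n : ℝ) ^ 5 * ∑ k ∈ Finset.Ico 1 (n ^ 3),
      1 / ε * (smallInterval ε n k).indicator (fun _ => (1 : ℝ)) x)

/-- The measure `μ = ∑_{n ≥ 1} μ_n`, where `μ_n` is `spreadMeasure (ε n) n`, as a measure on `ℂ`
carried by the real line. -/
def totikMeasure (ε : ℕ → ℝ) : Measure ℂ :=
  (Measure.sum fun n : ℕ => spreadMeasure (ε (n + 1)) (n + 1)).map fun x : ℝ => (x : ℂ)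

/-- The union of all the intervals `[k / n³ - ε n, k / n³ + ε n]`, `n ≥ 1`, `1 ≤ k ≤ n³ - 1`. -/
def totikSet (ε : ℕ → ℝ) : Set ℂ :=
  (fun x : ℝ => (x : ℂ)) '' ⋃ n ∈ Ici 1, ⋃ k ∈ Finset.Ico 1 (n ^ 3), smallInterval (ε n) n k

end BernsteinMarkov

end

/-!
The radii are `ε n = exp (-4 ^ (j + 4))`, where `j = Nat.pair n (n ^ 3)` bounds the codes of all
intervals of the `n`-th generation. With this choice the `j`-th interval of the whole family has
length at most of order `exp (-4 ^ (j + 4))`, and every claim follows from one of four facts.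

*Capacity.* A probability measure on a compact subset of `E` gives mass at least `2 ^ (-j - 2)` to
some interval `j`, whose length is so small that the pairs of points in this interval alone
contribute at least `3` to the energy (`three_le_logEnergy`), and `exp (-3) < 1 / 8`.

*Polynomials.* If `p` has degree at most `m` and attains its maximum over `[0, 1]` at `x₀`, then
Markov's inequality shows that `|p|` is at least half of the maximum within distance `2 / n ^ 3` of
`x₀`, for `n = m + 16`. An interval of generation `n` lies that close to `x₀` and has mass
`2 / n ^ 5`, so the Bernstein–Markov constant grows only polynomially (`iSup_enorm_eval_le`).
Markov's inequality, up to a constant, comes by rescaling from its endpoint case, where Chebyshev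
polynomials are extremal.

*A function of `L(ℂ)` that is small on `E`.* The function `4 + ∑ 2 ^ (-j - 1) log |z - c j|`, with
`c j` the centre of the `j`-th interval (and `0` for unused codes `j`), belongs to `L(ℂ)`, is
nonpositive on the carrier `E`, and is at least `4` at the point `2` (`atomicPotential`). A function of `L(ℂ)` that is nonpositive on
all of `[0, 1]` is at most `log 3 + 2 < 4` at `2` (`le_log_one_add_norm_of_mem_lelongClass`). So
`V_E^*` and `V_K^*` differ at `2`; moreover the function is positive somewhere on `[0, 1]`, and its
large multiples violate the subharmonic Bernstein–Markov property.

*Polar sets.* Since `μ` is absolutely continuous with respect to length, it suffices that a polar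
set meets the line in a null set. If `u = -∞` on a compact `F ⊆ ℝ` of positive length, the
potential `p` of Lebesgue measure on `F` is bounded below and harmonic off `F`; comparing `u` with
`M + t (p - c)` and letting `t → ∞` gives `u = -∞` on a disc, hence on a whole component.

The last two facts both rest on one comparison principle, `IsSubharmonicOn.le_of_boundary`.
-/

noncomputable section

namespace BernsteinMarkov

/-! ### Subharmonic functions: quantitative sub-mean value inequality and comparison principle -/

theorem toENNReal_add_toENNReal_sub_add {x : EReal} {g : ℝ} (h : x ≤ g) :
    x.toENNReal + ((g : EReal) - x).toENNReal + ENNReal.ofReal (-g) =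
      (-x).toENNReal + ENNReal.ofReal g := by
  induction x with
  | bot => simp
  | top => simp at h
  | coe x =>
    have hx : x ≤ g := by exact_mod_cast h
    rw [← EReal.coe_sub, ← EReal.coe_neg]
    simp only [EReal.toENNReal_of_ne_top (EReal.coe_ne_top _), EReal.toReal_coe]
    rcases le_total 0 x with h0 | h0 <;> rcases le_total 0 g with h1 | h1
    · rw [ENNReal.ofReal_of_nonpos (neg_nonpos.2 h1), ENNReal.ofReal_of_nonpos (neg_nonpos.2 h0),
        ← ENNReal.ofReal_add h0 (by linarith)]
      simp
    · have : x = 0 := by linarith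
      have : g = 0 := by linarith
      subst_vars
      simp
    · rw [ENNReal.ofReal_of_nonpos (neg_nonpos.2 h1), ENNReal.ofReal_of_nonpos h0,
        ← ENNReal.ofReal_add (by linarith) h1]
      simp [add_comm, sub_eq_add_neg]
    · rw [ENNReal.ofReal_of_nonpos h1, ENNReal.ofReal_of_nonpos h0, zero_add,
        ← ENNReal.ofReal_add (by linarith) (by linarith), add_zero]
      congr 1
      ring

/-- For a function with an integrable majorant `g`, the integral is that of `g` minus that of the
nonnegative gap; this form avoids differences of infinite quantities. -/
theorem erealIntegral_eq_sub_lintegral {α : Type*} [MeasurableSpace α] {ν : Measure α}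
    {f : α → EReal} {g : α → ℝ} (hf : Measurable f) (hg : Integrable g ν)
    (hfg : ∀ x, f x ≤ g x) :
    erealIntegral f ν =
      ((∫ x, g x ∂ν : ℝ) : EReal) -
        ((∫⁻ x, ((g x : EReal) - f x).toENNReal ∂ν : ENNReal) : EReal) := by
  have hgm : AEMeasurable g ν := hg.1.aemeasurable
  have key : (∫⁻ x, (f x).toENNReal ∂ν) + (∫⁻ x, ((g x : EReal) - f x).toENNReal ∂ν) +
      (∫⁻ x, ENNReal.ofReal (-g x) ∂ν) =
      (∫⁻ x, (-f x).toENNReal ∂ν) + ∫⁻ x, ENNReal.ofReal (g x) ∂ν := by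
    have hfn : Measurable fun x => (-f x).toENNReal := hf.neg.ereal_toENNReal
    rw [← lintegral_add_left hf.ereal_toENNReal, ← lintegral_add_right',
      ← lintegral_add_left hfn]
    · exact lintegral_congr fun x => toENNReal_add_toENNReal_sub_add (hfg x)
    · exact hgm.neg.ennreal_ofReal
  have hgp : ∫⁻ x, ENNReal.ofReal (g x) ∂ν ≠ ⊤ := hg.lintegral_lt_top.ne
  have hgn : ∫⁻ x, ENNReal.ofReal (-g x) ∂ν ≠ ⊤ := hg.neg.lintegral_lt_top.ne
  have hfp : ∫⁻ x, (f x).toENNReal ∂ν ≠ ⊤ := by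
    refine ne_top_of_le_ne_top hgp (lintegral_mono fun x => ?_)
    have := EReal.toENNReal_le_toENNReal (hfg x)
    simpa [EReal.toENNReal_of_ne_top (EReal.coe_ne_top _)] using this
  rw [erealIntegral, integral_eq_lintegral_pos_part_sub_lintegral_neg_part hg]
  generalize (∫⁻ x, (f x).toENNReal ∂ν) = a at *
  generalize (∫⁻ x, (-f x).toENNReal ∂ν) = b at *
  generalize (∫⁻ x, ((g x : EReal) - f x).toENNReal ∂ν) = c at *
  generalize (∫⁻ x, ENNReal.ofReal (g x) ∂ν) = p at *
  generalize (∫⁻ x, ENNReal.ofReal (-g x) ∂ν) = q at *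
  lift a to NNReal using hfp
  lift p to NNReal using hgp
  lift q to NNReal using hgn
  induction c with
  | top =>
    have : b = ⊤ := by
      by_contra hb
      lift b to NNReal using hb
      simp [← ENNReal.coe_add] at key
    subst this
    simp
  | coe c =>
    have hb : b ≠ ⊤ := by
      rintro rfl
      simp [← ENNReal.coe_add] at key
    lift b to NNReal using hb
    have key' : (a : ℝ) + c + q = b + p := by exact_mod_cast key
    have e : ∀ t : NNReal, (((t : ENNReal) : EReal)) = ((t : ℝ) : EReal) := fun _ => rfl
    simp only [e, ← EReal.coe_sub, ENNReal.coe_toReal]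
    congr 1
    linarith

theorem IsSubharmonicOn.upperSemicontinuous_comp_circleMap {u : ℂ → EReal} {U : Set ℂ}
    (hu : IsSubharmonicOn u U) {z : ℂ} {r : ℝ} (hr : 0 < r) (hU : Metric.closedBall z r ⊆ U) :
    UpperSemicontinuous fun θ : ℝ => u (circleMap z r θ) := by
  rw [← upperSemicontinuousOn_univ_iff]
  exact hu.usc.comp (continuous_circleMap z r).continuousOn fun θ _ =>
    hU (circleMap_mem_closedBall z hr.le θ)

theorem integral_circleMap_eq_circleAverage (g : ℂ → ℝ) (z : ℂ) (r : ℝ) :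
    ∫ θ in Ioc 0 (2 * Real.pi), g (circleMap z r θ) = 2 * Real.pi * Real.circleAverage g z r := by
  rw [Real.circleAverage_def, intervalIntegral.integral_of_le Real.two_pi_pos.le, smul_eq_mul,
    mul_inv_cancel_left₀ Real.two_pi_pos.ne']

/-- Quantitative sub-mean value inequality: if `g` is integrable and majorizes `u` on a circle,
then `u` at the centre lies below the mean of `g` by at least the mean of the gap `g - u`. -/
theorem IsSubharmonicOn.le_circleAverage_sub {u : ℂ → EReal} {U : Set ℂ}
    (hu : IsSubharmonicOn u U) {z : ℂ} {r : ℝ} (hr : 0 < r) (hU : Metric.closedBall z r ⊆ U)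
    {g : ℂ → ℝ} (hg : CircleIntegrable g z r)
    (hug : ∀ θ : ℝ, u (circleMap z r θ) ≤ g (circleMap z r θ)) :
    u z ≤ (((2 * Real.pi)⁻¹ : ℝ) : EReal) *
      (((2 * Real.pi * Real.circleAverage g z r : ℝ) : EReal) -
      ((∫⁻ θ in Ioc 0 (2 * Real.pi),
        ((g (circleMap z r θ) : EReal) - u (circleMap z r θ)).toENNReal : ENNReal) : EReal)) := by
  have h1 := hu.submean z r hr hU
  rw [erealIntegral_eq_sub_lintegral (g := fun θ => g (circleMap z r θ))
    (hu.upperSemicontinuous_comp_circleMap hr hU).measurable _ hug] at h1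
  · rwa [integral_circleMap_eq_circleAverage] at h1
  · exact (intervalIntegrable_iff_integrableOn_Ioc_of_le Real.two_pi_pos.le).1 hg

theorem IsSubharmonicOn.lt_circleAverage {u : ℂ → EReal} {U : Set ℂ}
    (hu : IsSubharmonicOn u U) {z : ℂ} {r : ℝ} (hr : 0 < r) (hU : Metric.closedBall z r ⊆ U)
    {g : ℂ → ℝ} (hg : Continuous fun θ => g (circleMap z r θ))
    (hug : ∀ θ : ℝ, u (circleMap z r θ) ≤ g (circleMap z r θ))
    (hlt : u (z + r) < g (z + r)) :
    u z < Real.circleAverage g z r := by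
  have h := hu.le_circleAverage_sub hr hU (hg.intervalIntegrable _ _) hug
  set L : ENNReal := ∫⁻ θ in Ioc 0 (2 * Real.pi),
        ((g (circleMap z r θ) : EReal) - u (circleMap z r θ)).toENNReal with hL
  have hLpos : L ≠ 0 := by
    intro h0
    have hm : Measurable fun θ =>
        ((g (circleMap z r θ) : EReal) - u (circleMap z r θ)).toENNReal :=
      ((measurable_coe_real_ereal.comp hg.measurable).sub
        (hu.upperSemicontinuous_comp_circleMap hr hU).measurable).ereal_toENNReal
    rw [hL, lintegral_eq_zero_iff hm] at h0
    -- By semicontinuity the inequality stays strict for small angles.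
    obtain ⟨q, hq1, hq2⟩ := EReal.lt_iff_exists_real_btwn.1 hlt
    have e0 : circleMap z r 0 = z + r := by simp [circleMap]
    have n1 : ∀ᶠ θ in 𝓝 (0 : ℝ), u (circleMap z r θ) < q :=
      hu.upperSemicontinuous_comp_circleMap hr hU 0 q (by simpa [e0] using hq1)
    have n2 : ∀ᶠ θ in 𝓝 (0 : ℝ), q < g (circleMap z r θ) :=
      hg.continuousAt.eventually_const_lt (by simpa [e0] using hq2)
    obtain ⟨δ, hδ, hball⟩ := Metric.eventually_nhds_iff.1 (n1.and n2)
    have hsub : Ioo 0 (min δ (2 * Real.pi)) ⊆ {θ | ¬ ((g (circleMap z r θ) : EReal) -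
        u (circleMap z r θ)).toENNReal = (0 : ℝ → ENNReal) θ} ∩ Ioc 0 (2 * Real.pi) := by
      intro θ hθ
      have hb := hball (y := θ) (by
        rw [Real.dist_eq, sub_zero, abs_of_pos hθ.1]; exact hθ.2.trans_le (min_le_left _ _))
      refine ⟨?_, hθ.1, (hθ.2.trans_le (min_le_right _ _)).le⟩
      have : u (circleMap z r θ) < g (circleMap z r θ) := hb.1.trans (by exact_mod_cast hb.2)
      simp only [mem_ofPred_eq, Pi.zero_apply, EReal.toENNReal_eq_zero_iff, not_le]
      exact EReal.sub_pos.2 this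
    have h2 : volume (Ioo 0 (min δ (2 * Real.pi))) = 0 := by
      refine measure_mono_null hsub ?_
      rw [Filter.EventuallyEq, ae_restrict_iff' measurableSet_Ioc] at h0
      refine measure_mono_null ?_ (ae_iff.1 h0)
      rintro θ ⟨a, b⟩
      exact fun h => a (h b)
    rw [Real.volume_Ioo, ENNReal.ofReal_eq_zero, sub_zero] at h2
    exact absurd (lt_min hδ Real.two_pi_pos) (not_lt.2 h2)
  refine h.trans_lt ?_
  clear_value L
  have h2π : (0 : ℝ) < (2 * Real.pi)⁻¹ := by positivity
  induction L with
  | top =>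
    rw [EReal.coe_ennreal_top, EReal.sub_top, EReal.coe_mul_bot_of_pos h2π]
    exact EReal.bot_lt_coe _
  | coe L =>
    have e : (((L : ENNReal) : EReal)) = ((L : ℝ) : EReal) := rfl
    rw [e, ← EReal.coe_sub, ← EReal.coe_mul, EReal.coe_lt_coe_iff, inv_mul_lt_iff₀ Real.two_pi_pos]
    have : (0 : ℝ) < L := by
      have : L ≠ 0 := by simpa using hLpos
      exact_mod_cast pos_iff_ne_zero.2 this
    linarith

/-- Comparison principle. A subharmonic function on a neighbourhood of a compact set `D` lies below
a function `h` that is harmonic off a closed set `F` as soon as it does so at the boundary points of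
`D` and, up to an arbitrarily small error, near `F`. At a rightmost point where `u - h` attains a
positive maximum the sub-mean value inequality would fail on small circles. -/
theorem IsSubharmonicOn.le_of_boundary {u : ℂ → EReal} {U : Set ℂ} (hu : IsSubharmonicOn u U)
    {h : ℂ → ℝ} {D F : Set ℂ} (hD : IsCompact D) (hDU : D ⊆ U) (hF : IsClosed F)
    (hc : ContinuousOn h Fᶜ)
    (hmean : ∀ z r, 0 < r → Metric.closedBall z r ⊆ Fᶜ → Real.circleAverage h z r = h z)
    (hfront : ∀ z ∈ D \ F, z ∉ interior D → u z ≤ h z)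
    (hnear : ∀ z ∈ F, ∀ η : ℝ, 0 < η → ∀ᶠ ζ in 𝓝[Fᶜ] z, u ζ ≤ ((h ζ + η : ℝ) : EReal)) :
    ∀ z ∈ D \ F, u z ≤ h z := by
  intro z₁ hz₁
  by_contra! hlt
  set φ : ℂ → EReal := fun z => u z + ((-h z : ℝ) : EReal) with hφ
  have φ_lt_iff : ∀ z (c : ℝ), φ z < c ↔ u z < ((h z + c : ℝ) : EReal) := by
    intro z c
    simp only [hφ]
    rw [EReal.coe_neg, ← sub_eq_add_neg, EReal.sub_lt_iff (by simp) (by simp), EReal.coe_add,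
      add_comm]
  have hpos : 0 < φ z₁ := by
    by_contra! hle
    have h0 : ∀ c : ℝ, 0 < c → u z₁ < ((h z₁ + c : ℝ) : EReal) := fun c hc =>
      (φ_lt_iff _ _).1 (hle.trans_lt (by exact_mod_cast hc))
    obtain ⟨q, hq1, hq2⟩ := EReal.lt_iff_exists_real_btwn.1 hlt
    have := h0 (q - h z₁) (by rw [sub_pos]; exact_mod_cast hq1)
    rw [add_sub_cancel] at this
    exact absurd this hq2.not_gt
  obtain ⟨η, hη0, hη⟩ := EReal.lt_iff_exists_real_btwn.1 hpos
  have hη0 : 0 < η := by exact_mod_cast hη0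
  -- `V` is a neighbourhood of `F` on which `u - h` is small.
  set V : Set ℂ := interior {z | z ∉ F → φ z < η} with hV
  have hFV : F ⊆ V := by
    intro z hz
    rw [hV, mem_interior_iff_mem_nhds]
    have := eventually_nhdsWithin_iff.1 (hnear z hz (η / 2) (half_pos hη0))
    filter_upwards [this] with ζ hζ hζF
    rw [φ_lt_iff]
    refine (hζ hζF).trans_lt ?_
    exact_mod_cast (by linarith : h ζ + η / 2 < h ζ + η)
  have hVφ : ∀ z ∈ V, z ∉ F → φ z < η := fun z hz => interior_subset hz
  have hDV : IsCompact (D \ V) := hD.diff isOpen_interior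
  have hsub : D \ V ⊆ D \ F := sdiff_subset_sdiff_right hFV
  have hφusc : UpperSemicontinuousOn φ (D \ V) := by
    refine (hu.usc.mono (sdiff_subset.trans hDU)).add'
      (ContinuousOn.upperSemicontinuousOn ?_) fun x _ => ?_
    · exact continuous_coe_real_ereal.comp_continuousOn
        (hc.mono fun z hz => (hsub hz).2).neg
    · exact EReal.continuousAt_add (by simp) (by simp)
  have hz₁V : z₁ ∈ D \ V := ⟨hz₁.1, fun hv => (hVφ _ hv hz₁.2).not_gt hη⟩
  obtain ⟨z₂, hz₂, hmax⟩ := hφusc.exists_isMaxOn ⟨z₁, hz₁V⟩ hDV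
  have hmax' : ∀ z ∈ D \ F, φ z ≤ φ z₂ := by
    intro z hz
    by_cases hv : z ∈ V
    · exact (hVφ z hv hz.2).le.trans (hη.le.trans (hmax hz₁V))
    · exact hmax ⟨hz.1, hv⟩
  obtain ⟨m, hm⟩ : ∃ m : ℝ, φ z₂ = m := by
    have h1 : φ z₂ ≠ ⊤ := EReal.add_ne_top (hu.ne_top z₂ (hDU hz₂.1)) (EReal.coe_ne_top _)
    have h2 : φ z₂ ≠ ⊥ := (bot_lt_of_lt (hη.trans_le (hmax hz₁V))).ne'
    exact ⟨_, (EReal.coe_toReal h1 h2).symm⟩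
  have hmη : η < m := by
    have := hη.trans_le (hmax hz₁V)
    rw [hm] at this
    exact_mod_cast this
  have hT := hφusc.isCompact_inter_preimage_Ici hDV (m : EReal)
  obtain ⟨z₀, hz₀, hre⟩ := hT.exists_isMaxOn ⟨z₂, hz₂, hm.ge⟩ Complex.continuous_re.continuousOn
  have hz₀D : z₀ ∈ D \ F := hsub hz₀.1
  have hz₀φ : (m : EReal) ≤ φ z₀ := hz₀.2
  have hint : z₀ ∈ interior D := by
    by_contra hni
    have h1 := hfront z₀ hz₀D hni
    have h2 : φ z₀ < η := by
      rw [φ_lt_iff]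
      exact h1.trans_lt (by exact_mod_cast (by linarith : h z₀ < h z₀ + η))
    exact absurd (h2.trans (by exact_mod_cast hmη)) hz₀φ.not_gt
  obtain ⟨r, hr, hball⟩ := Metric.nhds_basis_closedBall.mem_iff.1
    (Filter.inter_mem (mem_interior_iff_mem_nhds.1 hint) (hF.isOpen_compl.mem_nhds hz₀D.2))
  have hcirc : ∀ θ : ℝ, circleMap z₀ r θ ∈ D \ F := fun θ =>
    hball (circleMap_mem_closedBall z₀ hr.le θ)
  have hle : ∀ z ∈ D \ F, u z ≤ ((h z + m : ℝ) : EReal) := by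
    intro z hz
    by_contra! hcon
    obtain ⟨q, hq1, hq2⟩ := EReal.lt_iff_exists_real_btwn.1 hcon
    have h1 : (q - h z : ℝ) ≤ φ z := by
      rw [← not_lt, φ_lt_iff, add_sub_cancel]
      exact hq2.not_gt
    have h2 := h1.trans ((hmax' z hz).trans hm.le)
    have h3 : q - h z ≤ m := by exact_mod_cast h2
    have h4 : h z + m < q := by exact_mod_cast hq1
    linarith
  have hcont : Continuous fun θ => h (circleMap z₀ r θ) :=
    hc.comp_continuous (continuous_circleMap z₀ r) fun θ => (hcirc θ).2
  have hfinal := hu.lt_circleAverage hr (fun z hz => hDU (hball hz).1)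
    (g := fun z => h z + m) (hcont.add continuous_const) (fun θ => hle _ (hcirc θ)) ?_
  · rw [Real.circleAverage_fun_add (hcont.intervalIntegrable _ _) (circleIntegrable_const _ _ _),
      hmean z₀ r hr (fun z hz => (hball hz).2), Real.circleAverage_const] at hfinal
    rw [← φ_lt_iff] at hfinal
    exact absurd hfinal hz₀φ.not_gt
  · -- The point of the circle to the right of `z₀` cannot be another maximum.
    have hp : z₀ + r ∈ D \ F := by simpa [circleMap] using hcirc 0
    rw [← φ_lt_iff]
    by_contra! hge
    have hV' : z₀ + r ∉ V := fun hv =>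
      absurd ((hVφ _ hv hp.2).trans (by exact_mod_cast hmη)) hge.not_gt
    have := hre ⟨⟨hp.1, hV'⟩, hge⟩
    simp at this
    linarith

/-! ### Logarithmic potentials of Lebesgue measure on compact sets of reals -/

/-- The logarithmic potential `∫_F log |z - x| dx` of Lebesgue measure on a set `F` of reals. -/
def linePotential (F : Set ℝ) (z : ℂ) : ℝ :=
  ∫ x in F, Real.log ‖z - x‖

theorem isClosed_ofReal_image {F : Set ℝ} (hF : IsCompact F) :
    IsClosed ((fun x : ℝ => (x : ℂ)) '' F) :=
  (hF.image Complex.continuous_ofReal).isClosed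

theorem norm_sub_ofReal_pos {F : Set ℝ} {z : ℂ} (hz : z ∈ ((fun x : ℝ => (x : ℂ)) '' F)ᶜ) {x : ℝ}
    (hx : x ∈ F) : 0 < ‖z - x‖ :=
  norm_pos_iff.2 (sub_ne_zero.2 fun h => hz ⟨x, hx, h.symm⟩)

theorem continuousOn_log_norm_sub_ofReal (F : Set ℝ) :
    ContinuousOn (fun q : ℂ × ℝ => Real.log ‖q.1 - q.2‖)
      (((fun x : ℝ => (x : ℂ)) '' F)ᶜ ×ˢ F) := by
  refine ContinuousOn.log (by fun_prop) fun q hq => ?_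
  exact (norm_sub_ofReal_pos hq.1 hq.2).ne'

theorem integrableOn_log_norm_sub {F : Set ℝ} (hF : IsCompact F) {z : ℂ}
    (hz : z ∈ ((fun x : ℝ => (x : ℂ)) '' F)ᶜ) :
    IntegrableOn (fun x : ℝ => Real.log ‖z - x‖) F :=
  ((continuousOn_log_norm_sub_ofReal F).comp (f := fun x : ℝ => (z, x)) (by fun_prop)
    fun _ hx => ⟨hz, hx⟩).integrableOn_compact hF

theorem continuousOn_linePotential {F : Set ℝ} (hF : IsCompact F) :
    ContinuousOn (linePotential F) ((fun x : ℝ => (x : ℂ)) '' F)ᶜ := by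
  intro z hz
  refine ContinuousAt.continuousWithinAt ?_
  obtain ⟨r, hr, hball⟩ := Metric.nhds_basis_closedBall.mem_iff.1
    ((isClosed_ofReal_image hF).isOpen_compl.mem_nhds hz)
  obtain ⟨C, hC⟩ := ((isCompact_closedBall z r).prod hF).exists_bound_of_continuousOn
    ((continuousOn_log_norm_sub_ofReal F).mono (prod_mono hball subset_rfl))
  refine continuousAt_of_dominated (bound := fun _ => C) ?_ ?_ ?_ ?_
  · filter_upwards [Metric.closedBall_mem_nhds z hr] with w hw
    exact (integrableOn_log_norm_sub hF (hball hw)).1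
  · filter_upwards [Metric.closedBall_mem_nhds z hr] with w hw
    filter_upwards [ae_restrict_mem hF.measurableSet] with x hx
    exact hC (w, x) ⟨hw, hx⟩
  · exact integrableOn_const hF.measure_lt_top.ne
  · filter_upwards [ae_restrict_mem hF.measurableSet] with x hx
    have : ‖z - x‖ ≠ 0 := (norm_sub_ofReal_pos hz hx).ne'
    fun_prop (disch := assumption)

theorem circleAverage_log_norm_sub_of_notMem_closedBall {z a : ℂ} {r : ℝ} (hr : 0 < r)
    (ha : a ∉ Metric.closedBall z r) :
    Real.circleAverage (fun w => Real.log ‖w - a‖) z r = Real.log ‖z - a‖ := by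
  have h1 : r < ‖z - a‖ := by
    rw [Metric.mem_closedBall, not_le, dist_comm, dist_eq_norm] at ha
    exact ha
  have h2 : 0 < ‖z - a‖ := hr.trans h1
  rw [circleAverage_log_norm_sub_const_eq_log_radius_add_posLog hr.ne', Real.posLog_eq_log,
    Real.log_mul (by positivity) h2.ne', Real.log_inv]
  · ring
  · rw [abs_of_pos (by positivity), ← div_eq_inv_mul, one_le_div hr]
    exact h1.le

theorem circleAverage_linePotential {F : Set ℝ} (hF : IsCompact F) {z : ℂ} {r : ℝ} (hr : 0 < r)
    (hball : Metric.closedBall z r ⊆ ((fun x : ℝ => (x : ℂ)) '' F)ᶜ) :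
    Real.circleAverage (linePotential F) z r = linePotential F z := by
  have hint : Integrable (Function.uncurry fun (θ x : ℝ) => Real.log ‖circleMap z r θ - x‖)
      ((volume.restrict (Ioc 0 (2 * Real.pi))).prod (volume.restrict F)) := by
    rw [Measure.prod_restrict]
    refine IntegrableOn.mono_set (t := Icc 0 (2 * Real.pi) ×ˢ F) ?_
      (prod_mono Ioc_subset_Icc_self subset_rfl)
    refine ContinuousOn.integrableOn_compact (isCompact_Icc.prod hF) ?_
    refine (continuousOn_log_norm_sub_ofReal F).comp
      (f := fun q : ℝ × ℝ => (circleMap z r q.1, q.2)) (Continuous.continuousOn (by fun_prop)) ?_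
    exact fun q hq => ⟨hball (circleMap_mem_closedBall z hr.le q.1), hq.2⟩
  have h1 := integral_circleMap_eq_circleAverage (linePotential F) z r
  unfold linePotential at h1
  rw [integral_integral_swap hint] at h1
  have h2 : ∫ x in F, ∫ θ in Ioc 0 (2 * Real.pi), Real.log ‖circleMap z r θ - x‖ =
      ∫ x in F, 2 * Real.pi * Real.log ‖z - x‖ := by
    refine setIntegral_congr_fun hF.measurableSet fun x hx => ?_
    rw [integral_circleMap_eq_circleAverage (fun w => Real.log ‖w - x‖),
      circleAverage_log_norm_sub_of_notMem_closedBall hr]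
    exact fun hx' => hball hx' ⟨x, hx, rfl⟩
  rw [h2, integral_const_mul] at h1
  exact (mul_left_cancel₀ Real.two_pi_pos.ne' h1).symm

theorem integrable_indicator_log : Integrable ((Ioc (-1 : ℝ) 1).indicator Real.log) := by
  rw [integrable_indicator_iff measurableSet_Ioc]
  exact (intervalIntegrable_iff_integrableOn_Ioc_of_le (by norm_num)).1
    intervalIntegral.intervalIntegrable_log'

theorem integral_indicator_log : ∫ x, (Ioc (-1 : ℝ) 1).indicator Real.log x = -2 := by
  rw [integral_indicator measurableSet_Ioc, ← intervalIntegral.integral_of_le (by norm_num),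
    integral_log]
  norm_num

/-- The potential is bounded below independently of `F`, because the negative part of `log |x|` has
integral `2` over the line. -/
theorem neg_two_le_linePotential {F : Set ℝ} (hF : IsCompact F) {z : ℂ}
    (hz : z ∈ ((fun x : ℝ => (x : ℂ)) '' F)ᶜ) : -2 ≤ linePotential F z := by
  have hi : Integrable fun x : ℝ => (Ioc (-1 : ℝ) 1).indicator Real.log (x - z.re) :=
    integrable_indicator_log.comp_sub_right z.re
  have hnonpos : ∀ t : ℝ, (Ioc (-1 : ℝ) 1).indicator Real.log t ≤ 0 := by
    intro t
    refine indicator_nonpos (fun t ht => ?_) t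
    rw [← Real.log_abs]
    exact Real.log_nonpos (abs_nonneg t) (abs_le.2 ⟨ht.1.le, ht.2⟩)
  calc (-2 : ℝ) = ∫ x : ℝ, (Ioc (-1 : ℝ) 1).indicator Real.log (x - z.re) := by
        rw [integral_sub_right_eq_self (fun x => (Ioc (-1 : ℝ) 1).indicator Real.log x),
          integral_indicator_log]
    _ ≤ ∫ x in F, (Ioc (-1 : ℝ) 1).indicator Real.log (x - z.re) := by
        have := integral_add_compl hF.measurableSet hi
        have h2 : ∫ x in Fᶜ, (Ioc (-1 : ℝ) 1).indicator Real.log (x - z.re) ≤ 0 :=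
          integral_nonpos fun x => hnonpos _
        linarith
    _ ≤ linePotential F z := by
        refine setIntegral_mono_on_ae hi.integrableOn (integrableOn_log_norm_sub hF hz)
          hF.measurableSet ?_
        -- The convention `log 0 = 0` breaks the pointwise bound at the single point `x = z.re`.
        filter_upwards [compl_mem_ae_iff.2 (measure_singleton z.re)] with x hne hx
        have h1 : |x - z.re| ≤ ‖z - x‖ := by
          have := Complex.abs_re_le_norm (z - x)
          rwa [Complex.sub_re, Complex.ofReal_re, abs_sub_comm] at this
        have h2 := norm_sub_ofReal_pos hz hx
        by_cases hm : x - z.re ∈ Ioc (-1 : ℝ) 1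
        · rw [indicator_of_mem hm]
          rw [← Real.log_abs]
          exact Real.log_le_log (abs_pos.2 (sub_ne_zero.2 hne)) h1
        · rw [indicator_of_notMem hm]
          refine Real.log_nonneg (le_trans ?_ h1)
          rw [mem_Ioc, not_and_or, not_lt, not_le] at hm
          rcases hm with hm | hm
          · exact le_trans (by linarith) (neg_le_abs _)
          · exact le_trans hm.le (le_abs_self _)

theorem linePotential_le {F : Set ℝ} (hF : IsCompact F) {z : ℂ}
    (hz : z ∈ ((fun x : ℝ => (x : ℂ)) '' F)ᶜ) {ρ : ℝ} (hρ : ∀ x ∈ F, ‖z - x‖ ≤ ρ) :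
    linePotential F z ≤ volume.real F * Real.log ρ := by
  have := setIntegral_mono_on (integrableOn_log_norm_sub hF hz)
    (integrableOn_const hF.measure_lt_top.ne (C := Real.log ρ)) hF.measurableSet fun x hx =>
      Real.log_le_log (norm_sub_ofReal_pos hz hx) (hρ x hx)
  simpa [linePotential] using this

theorem le_linePotential {F : Set ℝ} (hF : IsCompact F) {z : ℂ}
    (hz : z ∈ ((fun x : ℝ => (x : ℂ)) '' F)ᶜ) {ρ : ℝ} (hρ0 : 0 < ρ) (hρ : ∀ x ∈ F, ρ ≤ ‖z - x‖) :
    volume.real F * Real.log ρ ≤ linePotential F z := by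
  have := setIntegral_mono_on (integrableOn_const hF.measure_lt_top.ne (C := Real.log ρ))
    (integrableOn_log_norm_sub hF hz) hF.measurableSet fun x hx => Real.log_le_log hρ0 (hρ x hx)
  simpa [linePotential] using this

/-! ### A rough Bernstein–Walsh inequality on `[0, 1]` -/

theorem circleAverage_mul_linePotential_add {F : Set ℝ} (hF : IsCompact F) (a b : ℝ) {z : ℂ} {r : ℝ}
    (hr : 0 < r) (hball : Metric.closedBall z r ⊆ ((fun x : ℝ => (x : ℂ)) '' F)ᶜ) :
    Real.circleAverage (fun w => a * linePotential F w + b) z r = a * linePotential F z + b := by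
  have hc : Continuous fun θ => linePotential F (circleMap z r θ) :=
    (continuousOn_linePotential hF).comp_continuous (continuous_circleMap z r) fun θ =>
      hball (circleMap_mem_closedBall z hr.le θ)
  have hi : CircleIntegrable (fun w => a * linePotential F w) z r :=
    (hc.const_mul a).intervalIntegrable _ _
  rw [Real.circleAverage_fun_add hi (circleIntegrable_const _ _ _), Real.circleAverage_const]
  have := Real.circleAverage_fun_smul (a := a) (f := linePotential F) (c := z) (R := r)
  simp only [smul_eq_mul] at this
  rw [this, circleAverage_linePotential hF hr hball]

theorem isClosed_unitSegment : IsClosed unitSegment :=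
  isClosed_ofReal_image isCompact_Icc

theorem norm_le_one_of_mem_Icc {x : ℝ} (hx : x ∈ Icc (0 : ℝ) 1) : ‖(x : ℂ)‖ ≤ 1 := by
  rw [Complex.norm_real, Real.norm_of_nonneg hx.1]
  exact hx.2

/-- A rough form of the Bernstein–Walsh inequality. The potential of Lebesgue measure on `[0, 1]`
takes the place of Green's function, which costs an additive constant. -/
theorem le_linePotential_of_mem_lelongClass {u : ℂ → EReal} (hu : u ∈ lelongClass)
    (h0 : ∀ w ∈ unitSegment, u w ≤ 0) {z : ℂ} (hz : z ∉ unitSegment) :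
    u z ≤ ((linePotential (Icc 0 1) z + 2 : ℝ) : EReal) := by
  obtain ⟨hsub, C, hC⟩ := hu
  have hI : IsCompact (Icc (0 : ℝ) 1) := isCompact_Icc
  have key : ∀ δ : ℝ, 0 < δ →
      u z ≤ (((1 + δ) * linePotential (Icc 0 1) z + (1 + δ) * 2 : ℝ) : EReal) := by
    intro δ hδ
    rw [← Metric.cobounded_eq_cocompact, (hasBasis_cobounded_norm).eventually_iff] at hC
    obtain ⟨R₀, -, hR₀⟩ := hC
    set R : ℝ := max (max R₀ ‖z‖) (max 2 (1 + Real.exp ((C + 1) / δ))) with hR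
    have hR1 : R₀ ≤ R := (le_max_left _ _).trans (le_max_left _ _)
    have hR2 : ‖z‖ ≤ R := (le_max_right _ _).trans (le_max_left _ _)
    have hR3 : 2 ≤ R := (le_max_left _ _).trans (le_max_right _ _)
    have hR4 : 1 + Real.exp ((C + 1) / δ) ≤ R := (le_max_right _ _).trans (le_max_right _ _)
    refine hsub.le_of_boundary (h := fun w => (1 + δ) * linePotential (Icc 0 1) w + (1 + δ) * 2)
      (D := Metric.closedBall 0 R) (F := unitSegment)
      (isCompact_closedBall _ _) (subset_univ _) isClosed_unitSegment
      (((continuousOn_linePotential hI).const_smul (1 + δ)).add continuousOn_const)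
      (fun w r hr hb => circleAverage_mul_linePotential_add hI _ _ hr hb) ?_ ?_ z
      ⟨by simpa using hR2, hz⟩
    · rintro w ⟨hw1, hw2⟩ hw3
      rw [interior_closedBall _ (by linarith), Metric.mem_ball, dist_zero_right, not_lt] at hw3
      rw [Metric.mem_closedBall, dist_zero_right] at hw1
      have hw : ‖w‖ = R := le_antisymm hw1 hw3
      refine (hR₀ (show R₀ ≤ ‖w‖ by linarith)).trans ?_
      rw [EReal.coe_le_coe_iff, hw]
      have h1 : volume.real (Icc (0 : ℝ) 1) * Real.log (R - 1) ≤ linePotential (Icc 0 1) w := by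
        refine le_linePotential hI hw2 (by linarith) fun x hx => ?_
        have := norm_sub_norm_le w (x : ℂ)
        have := norm_le_one_of_mem_Icc hx
        linarith
      have h1' : Real.log (R - 1) ≤ linePotential (Icc 0 1) w := by simpa using h1
      have h2 : Real.log R ≤ Real.log (R - 1) + Real.log 2 := by
        rw [← Real.log_mul (by linarith) (by norm_num)]
        exact Real.log_le_log (by linarith) (by linarith)
      have h3 : (C + 1) / δ ≤ Real.log (R - 1) := by
        rw [Real.le_log_iff_exp_le (by linarith)]
        linarith
      have h4 : C + 1 ≤ δ * Real.log (R - 1) := by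
        rwa [div_le_iff₀' hδ] at h3
      have h5 := Real.log_two_lt_d9
      nlinarith
    · intro w hw η hη
      have h1 : ∀ᶠ ζ in 𝓝 w, u ζ < (η : EReal) := by
        have := hsub.usc w (mem_univ w) η ((h0 w hw).trans_lt (by exact_mod_cast hη))
        rwa [nhdsWithin_univ] at this
      filter_upwards [nhdsWithin_le_nhds h1, self_mem_nhdsWithin] with ζ hζ hζ'
      refine hζ.le.trans ?_
      rw [EReal.coe_le_coe_iff]
      have := neg_two_le_linePotential hI hζ'
      nlinarith
  refine ge_of_tendsto (x := 𝓝[>] (0 : ℝ)) (f := fun δ : ℝ =>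
    (((1 + δ) * linePotential (Icc 0 1) z + (1 + δ) * 2 : ℝ) : EReal)) ?_
    (eventually_mem_nhdsWithin.mono key)
  refine Tendsto.mono_left ?_ nhdsWithin_le_nhds
  have : Continuous fun δ : ℝ =>
    (((1 + δ) * linePotential (Icc 0 1) z + (1 + δ) * 2 : ℝ) : EReal) :=
      continuous_coe_real_ereal.comp (by fun_prop)
  simpa using this.tendsto 0

theorem le_log_one_add_norm_of_mem_lelongClass {u : ℂ → EReal} (hu : u ∈ lelongClass)
    (h0 : ∀ w ∈ unitSegment, u w ≤ 0) (z : ℂ) :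
    u z ≤ ((Real.log (1 + ‖z‖) + 2 : ℝ) : EReal) := by
  by_cases hz : z ∈ unitSegment
  · refine (h0 z hz).trans ?_
    have := Real.log_nonneg (show 1 ≤ 1 + ‖z‖ by linarith [norm_nonneg z])
    exact_mod_cast (by linarith : (0 : ℝ) ≤ Real.log (1 + ‖z‖) + 2)
  · refine (le_linePotential_of_mem_lelongClass hu h0 hz).trans ?_
    rw [EReal.coe_le_coe_iff]
    have := linePotential_le isCompact_Icc (F := Icc 0 1) hz (ρ := 1 + ‖z‖) fun x hx => by
      have := norm_sub_le z (x : ℂ)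
      have := norm_le_one_of_mem_Icc hx
      linarith
    simp at this
    linarith

theorem extremalFun_unitSegment_le (z : ℂ) :
    extremalFun unitSegment z ≤ ((Real.log (1 + ‖z‖) + 2 : ℝ) : EReal) :=
  iSup₂_le fun _ hu => le_log_one_add_norm_of_mem_lelongClass hu.1 hu.2 z

theorem extremalFunReg_unitSegment_le (z : ℂ) :
    extremalFunReg unitSegment z ≤ ((Real.log (1 + ‖z‖) + 2 : ℝ) : EReal) := by
  have hc : Continuous fun z : ℂ => ((Real.log (1 + ‖z‖) + 2 : ℝ) : EReal) := by
    refine continuous_coe_real_ereal.comp (Continuous.add (Continuous.log (by fun_prop) ?_)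
      continuous_const)
    intro x
    have := norm_nonneg x
    positivity
  rw [← (hc.tendsto z).limsup_eq]
  exact limsup_le_limsup (Eventually.of_forall extremalFun_unitSegment_le)

/-! ### Polar sets meet the real line in sets of length zero -/

theorem IsSubharmonicOn.exists_upper_bound {u : ℂ → EReal} {U : Set ℂ} (hu : IsSubharmonicOn u U)
    {D : Set ℂ} (hD : IsCompact D) (hDU : D ⊆ U) : ∃ M : ℝ, ∀ z ∈ D, u z ≤ M := by
  rcases D.eq_empty_or_nonempty with rfl | hne
  · exact ⟨0, by simp⟩
  obtain ⟨z₀, hz₀, hmax⟩ := (hu.usc.mono hDU).exists_isMaxOn hne hD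
  exact ⟨(u z₀).toReal, fun z hz => (hmax hz).trans (EReal.le_coe_toReal (hu.ne_top z₀ (hDU hz₀)))⟩

theorem IsSubharmonicOn.isOpen_lt {u : ℂ → EReal} {U : Set ℂ} (hu : IsSubharmonicOn u U)
    (hU : IsOpen U) (c : EReal) : IsOpen {z | z ∈ U ∧ u z < c} := by
  refine isOpen_iff_mem_nhds.2 fun z hz => ?_
  have := hu.usc z hz.1 c hz.2
  rw [hU.nhdsWithin_eq hz.1] at this
  exact Filter.inter_mem (hU.mem_nhds hz.1) this

theorem IsSubharmonicOn.measurableSet_eq_bot {u : ℂ → EReal} {U : Set ℂ}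
    (hu : IsSubharmonicOn u U) (hU : IsOpen U) : MeasurableSet {z | z ∈ U ∧ u z = ⊥} := by
  have : {z | z ∈ U ∧ u z = ⊥} = ⋂ n : ℕ, {z | z ∈ U ∧ u z < ((-n : ℝ) : EReal)} := by
    ext z
    simp only [mem_ofPred_eq, mem_iInter]
    constructor
    · rintro ⟨h1, h2⟩ n
      exact ⟨h1, h2 ▸ EReal.bot_lt_coe _⟩
    · intro h
      refine ⟨(h 0).1, EReal.eq_bot_iff_forall_lt _ |>.2 fun y => ?_⟩
      obtain ⟨n, hn⟩ := exists_nat_gt (-y)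
      exact (h n).2.trans (by exact_mod_cast (by linarith : -(n : ℝ) < y))
  rw [this]
  exact MeasurableSet.iInter fun n => (hu.isOpen_lt hU _).measurableSet

/-- A circle that meets an open set on which `u = -∞` carries mean `-∞`. -/
theorem IsSubharmonicOn.eq_bot_of_circle {u : ℂ → EReal} {U : Set ℂ} (hu : IsSubharmonicOn u U)
    {z w : ℂ} (hzw : z ≠ w) (hball : Metric.closedBall z (dist w z) ⊆ U)
    (hw : ∀ᶠ ζ in 𝓝 w, u ζ = ⊥) : u z = ⊥ := by
  have hr : 0 < dist w z := dist_pos.2 hzw.symm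
  obtain ⟨M, hM⟩ := hu.exists_upper_bound (isCompact_closedBall z (dist w z)) hball
  have h := hu.le_circleAverage_sub hr hball (g := fun _ => M) (circleIntegrable_const _ _ _)
    fun θ => hM _ (circleMap_mem_closedBall z hr.le θ)
  suffices htop : ∫⁻ θ in Ioc 0 (2 * Real.pi),
      ((M : EReal) - u (circleMap z (dist w z) θ)).toENNReal = ⊤ by
    rw [htop, EReal.coe_ennreal_top, EReal.sub_top, EReal.coe_mul_bot_of_pos (by positivity)] at h
    exact le_bot_iff.1 h
  -- The gap `M - u` is infinite on an arc of positive length ending at the angle `θ₀` of `w`.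
  obtain ⟨θ₀, hθ₀, hθw⟩ : ∃ θ₀ ∈ Ioc 0 (2 * Real.pi), circleMap z (dist w z) θ₀ = w := by
    have : w ∈ circleMap z (dist w z) '' Ioc 0 (2 * Real.pi) := by
      rw [image_circleMap_Ioc, abs_of_pos hr]
      exact Metric.mem_sphere.2 rfl
    exact this
  have hev : ∀ᶠ θ in 𝓝 θ₀, u (circleMap z (dist w z) θ) = ⊥ := by
    have hc := (continuous_circleMap z (dist w z)).continuousAt (x := θ₀)
    rw [ContinuousAt, hθw] at hc
    exact hc.eventually hw
  obtain ⟨δ, hδ, hδb⟩ := Metric.eventually_nhds_iff.1 hev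
  have hpos : volume (Ioo (max 0 (θ₀ - δ)) θ₀) ≠ 0 := by
    rw [Real.volume_Ioo, Ne, ENNReal.ofReal_eq_zero, not_le, sub_pos]
    exact max_lt hθ₀.1 (by linarith)
  rw [eq_top_iff]
  calc ⊤ = ∫⁻ θ in Ioo (max 0 (θ₀ - δ)) θ₀, ⊤ := by
        rw [setLIntegral_const, ENNReal.top_mul hpos]
    _ ≤ ∫⁻ θ in Ioo (max 0 (θ₀ - δ)) θ₀,
          ((M : EReal) - u (circleMap z (dist w z) θ)).toENNReal := by
        refine setLIntegral_mono' measurableSet_Ioo fun θ hθ => ?_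
        rw [hδb (y := θ)]
        · simp
        · rw [Real.dist_eq, abs_lt]
          have := (le_max_right 0 (θ₀ - δ)).trans_lt hθ.1
          constructor <;> linarith [hθ.2]
    _ ≤ _ := by
        refine lintegral_mono_set fun θ hθ => ?_
        exact ⟨(le_max_left _ _).trans_lt hθ.1, hθ.2.le.trans hθ₀.2⟩

theorem IsSubharmonicOn.eq_bot_on_connectedComponentIn {u : ℂ → EReal} {U : Set ℂ}
    (hu : IsSubharmonicOn u U) (hU : IsOpen U) {z₀ : ℂ} (hz₀ : z₀ ∈ U)
    (h : ∀ᶠ ζ in 𝓝 z₀, u ζ = ⊥) : ∀ z ∈ connectedComponentIn U z₀, u z = ⊥ := by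
  set W : Set ℂ := interior {z | u z = ⊥} with hW
  have hWmem : ∀ w, w ∈ W ↔ ∀ᶠ ζ in 𝓝 w, u ζ = ⊥ := fun w => mem_interior_iff_mem_nhds
  have hWbot : ∀ w ∈ W, u w = ⊥ := fun w hw => ((hWmem w).1 hw).self_of_nhds
  suffices hs : connectedComponentIn U z₀ ⊆ W from fun z hz => hWbot z (hs hz)
  refine isPreconnected_connectedComponentIn.subset_of_closure_inter_subset isOpen_interior
    ⟨z₀, mem_connectedComponentIn hz₀, (hWmem _).2 h⟩ ?_
  rintro a ⟨ha, haU⟩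
  obtain ⟨r, hr, hb⟩ := Metric.isOpen_iff.1 hU a (connectedComponentIn_subset U z₀ haU)
  obtain ⟨w, hwW, hwa⟩ := Metric.mem_closure_iff.1 ha (r / 4) (by positivity)
  rw [hWmem]
  filter_upwards [Metric.ball_mem_nhds a (show 0 < r / 4 by positivity)] with z hz
  rw [Metric.mem_ball] at hz
  rcases eq_or_ne z w with rfl | hzw
  · exact hWbot z hwW
  refine hu.eq_bot_of_circle hzw (fun ζ hζ => hb ?_) ((hWmem w).1 hwW)
  rw [Metric.mem_closedBall] at hζ
  rw [Metric.mem_ball]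
  have h1 := dist_triangle ζ z a
  have h2 := dist_triangle w a z
  rw [dist_comm w a, dist_comm a z] at h2
  linarith

/-- If `u = -∞` on a compact set `F` of reals of positive length, then `u = -∞` on a whole disc: off
`F`, the function `u` lies below `M + t (p - c)` for every `t > 0`, where `p` is the potential of
`F` and `c` a lower bound for `p` on a large circle, and `p < c` inside a smaller circle. -/
theorem IsSubharmonicOn.eventually_eq_bot_of_volume_pos {u : ℂ → EReal} {U : Set ℂ}
    (hu : IsSubharmonicOn u U) {s R : ℝ} (hR : 0 < R)
    (hball : Metric.closedBall (s : ℂ) R ⊆ U) {F : Set ℝ} (hF : IsCompact F)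
    (hFs : F ⊆ Icc (s - R / 4) (s + R / 4)) (hpos : 0 < volume F) (hbot : ∀ x ∈ F, u x = ⊥) :
    ∀ᶠ ζ in 𝓝 (s : ℂ), u ζ = ⊥ := by
  obtain ⟨M, hM⟩ := hu.exists_upper_bound (isCompact_closedBall (s : ℂ) R) hball
  set c : ℝ := volume.real F * Real.log (3 * R / 4) with hc
  have hvol : 0 < volume.real F := ENNReal.toReal_pos hpos.ne' hF.measure_lt_top.ne
  have hdist : ∀ x ∈ F, ‖(s : ℂ) - x‖ ≤ R / 4 := by
    intro x hx
    rw [← Complex.ofReal_sub, Complex.norm_real, Real.norm_eq_abs, abs_le]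
    constructor <;> linarith [(hFs hx).1, (hFs hx).2]
  have key : ∀ t : ℝ, 0 < t → ∀ z ∈ Metric.closedBall (s : ℂ) R \ ((fun x : ℝ => (x : ℂ)) '' F),
      u z ≤ ((t * linePotential F z + (M - t * c) : ℝ) : EReal) := by
    intro t ht
    refine hu.le_of_boundary (h := fun z => t * linePotential F z + (M - t * c))
      (isCompact_closedBall _ _) hball (isClosed_ofReal_image hF)
      (((continuousOn_linePotential hF).const_smul t).add continuousOn_const)
      (fun w r hr hb => circleAverage_mul_linePotential_add hF _ _ hr hb) ?_ ?_
    · rintro z ⟨hz1, hz2⟩ hz3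
      rw [interior_closedBall _ hR.ne', Metric.mem_ball, dist_eq_norm, not_lt] at hz3
      refine (hM z hz1).trans ?_
      rw [EReal.coe_le_coe_iff]
      have h1 : c ≤ linePotential F z := by
        refine le_linePotential hF hz2 (by positivity) fun x hx => ?_
        have h2 := norm_sub_norm_le (z - s) ((x : ℂ) - s)
        rw [sub_sub_sub_cancel_right] at h2
        have h3 := hdist x hx
        rw [norm_sub_rev] at h3
        linarith
      nlinarith
    · rintro _ ⟨x, hx, rfl⟩ η hη
      have hxU : (x : ℂ) ∈ U := by
        refine hball ?_
        rw [Metric.mem_closedBall, dist_comm, dist_eq_norm]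
        linarith [hdist x hx]
      have hb : ∀ᶠ ζ in 𝓝[U] (x : ℂ), u ζ < ((t * (-2) + (M - t * c) : ℝ) : EReal) :=
        hu.usc x hxU _ (show u x < _ from hbot x hx ▸ EReal.bot_lt_coe _)
      have hU : U ∈ 𝓝 (x : ℂ) := by
        refine mem_of_superset (Metric.closedBall_mem_nhds_of_mem ?_) hball
        rw [Metric.mem_ball, dist_comm, dist_eq_norm]
        linarith [hdist x hx]
      rw [nhdsWithin_eq_nhds.2 hU] at hb
      filter_upwards [nhdsWithin_le_nhds hb, self_mem_nhdsWithin] with ζ hζ hζ'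
      refine hζ.le.trans ?_
      rw [EReal.coe_le_coe_iff]
      have := neg_two_le_linePotential hF hζ'
      nlinarith
  filter_upwards [Metric.ball_mem_nhds (s : ℂ) (show 0 < R / 4 by positivity)] with z hz
  by_cases hzF : z ∈ (fun x : ℝ => (x : ℂ)) '' F
  · obtain ⟨x, hx, rfl⟩ := hzF
    exact hbot x hx
  rw [Metric.mem_ball, dist_eq_norm] at hz
  have hlt : linePotential F z < c := by
    have h1 := linePotential_le hF hzF (ρ := R / 2) fun x hx => by
      have := norm_sub_le_norm_sub_add_norm_sub z s x
      linarith [hdist x hx]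
    refine h1.trans_lt (mul_lt_mul_of_pos_left (Real.log_lt_log (by positivity) ?_) hvol)
    linarith
  rw [EReal.eq_bot_iff_forall_lt]
  intro y
  set t : ℝ := (|M - y| + 1) / (c - linePotential F z) with ht
  have hcp : 0 < c - linePotential F z := by linarith
  have ht0 : 0 < t := by positivity
  refine (key t ht0 z ⟨?_, hzF⟩).trans_lt ?_
  · rw [Metric.mem_closedBall, dist_eq_norm]
    linarith
  · have h1 : t * (c - linePotential F z) = |M - y| + 1 := div_mul_cancel₀ _ hcp.ne'
    have h2 := le_abs_self (M - y)
    rw [EReal.coe_lt_coe_iff]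
    linarith

/-- A polar set meets the real line in a set of length zero. Otherwise `u = -∞` on a set of reals
that has positive length near one of its points, and then on the component of that point. -/
theorem IsPolar.volume_preimage_ofReal {F : Set ℂ} (hF : IsPolar F) :
    volume ((fun x : ℝ => (x : ℂ)) ⁻¹' F) = 0 := by
  obtain ⟨U, u, hU, hFU, hu, hcomp, hbot⟩ := hF
  have hcont : Continuous fun x : ℝ => (x : ℂ) := Complex.continuous_ofReal
  set A : Set ℝ := (fun x : ℝ => (x : ℂ)) ⁻¹' {z | z ∈ U ∧ u z = ⊥} with hA
  have hAm : MeasurableSet A := hcont.measurable (hu.measurableSet_eq_bot hU)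
  refine measure_mono_null (fun x hx => ⟨hFU hx, hbot _ hx⟩ : _ ⊆ A) ?_
  by_contra hne
  obtain ⟨s, hsA, hs⟩ : ∃ s ∈ A, ∀ N ∈ 𝓝[A] s, volume N ≠ 0 := by
    by_contra! hcon
    exact hne (measure_null_of_locally_null A hcon)
  obtain ⟨R, hR, hball⟩ := Metric.nhds_basis_closedBall.mem_iff.1 (hU.mem_nhds hsA.1)
  have hN : A ∩ Icc (s - R / 4) (s + R / 4) ∈ 𝓝[A] s :=
    Filter.inter_mem self_mem_nhdsWithin
      (nhdsWithin_le_nhds (Icc_mem_nhds (by linarith) (by linarith)))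
  obtain ⟨K, hKN, hK, hKpos⟩ := (hAm.inter measurableSet_Icc).exists_lt_isCompact
    (pos_iff_ne_zero.2 (hs _ hN))
  have hev := hu.eventually_eq_bot_of_volume_pos hR hball hK (fun x hx => (hKN hx).2) hKpos
    fun x hx => (hKN hx).1.2
  obtain ⟨w, hw, hwne⟩ := hcomp s hsA.1
  exact hwne (hu.eq_bot_on_connectedComponentIn hU hsA.1 hev w hw)

/-! ### Potentials of atomic measures in the class `L(ℂ)` -/

/-- The kernel `log (1 + |z|) - log |z - c|`, with value `∞` at `z = c`. It is used for `|c| ≤ 1`,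
where the difference is nonnegative and the truncation `toENNReal` has no effect. -/
def logKernel (z c : ℂ) : ENNReal :=
  (-ENNReal.log (ENNReal.ofReal (‖z - c‖ / (1 + ‖z‖)))).toENNReal

theorem one_add_norm_pos (z : ℂ) : 0 < 1 + ‖z‖ := by positivity

theorem continuous_logKernel (c : ℂ) : Continuous fun z => logKernel z c := by
  have h : Continuous fun z : ℂ => ‖z - c‖ / (1 + ‖z‖) :=
    Continuous.div (by fun_prop) (by fun_prop) fun z => (one_add_norm_pos z).ne'
  exact EReal.continuous_toENNReal.comp
    (continuous_neg.comp (ENNReal.continuous_log.comp (ENNReal.continuous_ofReal.comp h)))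

theorem logKernel_self (c : ℂ) : logKernel c c = ⊤ := by
  simp [logKernel]

theorem logKernel_of_ne {z c : ℂ} (h : z ≠ c) :
    logKernel z c = ENNReal.ofReal (Real.log (1 + ‖z‖) - Real.log ‖z - c‖) := by
  have h1 : 0 < ‖z - c‖ := norm_pos_iff.2 (sub_ne_zero.2 h)
  rw [logKernel, ENNReal.log_ofReal_of_pos (div_pos h1 (one_add_norm_pos z)),
    Real.log_div h1.ne' (one_add_norm_pos z).ne', ← EReal.coe_neg,
    EReal.toENNReal_of_ne_top (EReal.coe_ne_top _), EReal.toReal_coe, neg_sub]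

theorem log_norm_sub_le {z c : ℂ} (hc : ‖c‖ ≤ 1) : Real.log ‖z - c‖ ≤ Real.log (1 + ‖z‖) := by
  have h2 : ‖z - c‖ ≤ 1 + ‖z‖ := (norm_sub_le z c).trans (by linarith)
  rcases (norm_nonneg (z - c)).eq_or_lt with h | h
  · rw [← h, Real.log_zero]
    exact Real.log_nonneg (by linarith [norm_nonneg z])
  · exact Real.log_le_log h h2

theorem ofReal_le_logKernel {z c : ℂ} {a : ℝ}
    (h : z ≠ c → a ≤ Real.log (1 + ‖z‖) - Real.log ‖z - c‖) :
    ENNReal.ofReal a ≤ logKernel z c := by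
  rcases eq_or_ne z c with rfl | hne
  · rw [logKernel_self]
    exact le_top
  · rw [logKernel_of_ne hne]
    exact ENNReal.ofReal_le_ofReal (h hne)

theorem log_norm_sub_le_circleAverage {z c : ℂ} (hzc : z ≠ c) {r : ℝ} (hr : 0 < r) :
    Real.log ‖z - c‖ ≤ Real.circleAverage (fun w => Real.log ‖w - c‖) z r := by
  rw [circleAverage_log_norm_sub_const_eq_log_radius_add_posLog hr.ne']
  have h1 : 0 < ‖z - c‖ := norm_pos_iff.2 (sub_ne_zero.2 hzc)
  have h2 : Real.log (r⁻¹ * ‖z - c‖) ≤ Real.posLog (r⁻¹ * ‖z - c‖) := le_max_right _ _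
  rw [Real.log_mul (by positivity) h1.ne', Real.log_inv] at h2
  linarith

theorem continuous_log_one_add_norm : Continuous fun z : ℂ => Real.log (1 + ‖z‖) :=
  Continuous.log (by fun_prop) fun z => (one_add_norm_pos z).ne'

theorem ae_circleMap_ne (z c : ℂ) {r : ℝ} (hr : 0 < r) :
    ∀ᵐ θ ∂(volume.restrict (Ioc 0 (2 * Real.pi))), circleMap z r θ ≠ c := by
  rw [ae_restrict_iff' measurableSet_Ioc]
  have hinj : ({θ | θ ∈ Ioc 0 (2 * Real.pi) ∧ circleMap z r θ = c}).Subsingleton := by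
    rintro a ⟨ha, ha'⟩ b ⟨hb, hb'⟩
    exact injOn_circleMap_of_abs_sub_le hr.ne'
      (by rw [zero_sub, abs_neg, abs_of_pos Real.two_pi_pos])
      (by rwa [uIoc_of_le Real.two_pi_pos.le]) (by rwa [uIoc_of_le Real.two_pi_pos.le])
      (ha'.trans hb'.symm)
  have := hinj.measure_zero volume
  rw [ae_iff]
  refine measure_mono_null (fun θ hθ => ?_) this
  simpa [and_assoc] using hθ

/-- Super-mean value property of the kernel, up to the mean of the majorant `log (1 + |z|) + M`,
written additively to stay within `[0, ∞]`. -/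
theorem lintegral_logKernel_add_le {z c : ℂ} (hc : ‖c‖ ≤ 1) {r : ℝ} (hr : 0 < r) {M : ℝ}
    (hM : 0 ≤ M) :
    (∫⁻ θ in Ioc 0 (2 * Real.pi), logKernel (circleMap z r θ) c) +
        ENNReal.ofReal (2 * Real.pi * (Real.log (1 + ‖z‖) + M)) ≤
      ENNReal.ofReal (2 * Real.pi *
        Real.circleAverage (fun w => Real.log (1 + ‖w‖) + M) z r) +
        ENNReal.ofReal (2 * Real.pi) * logKernel z c := by
  rcases eq_or_ne z c with rfl | hzc
  · rw [logKernel_self, ENNReal.mul_top (by simp [Real.pi_pos])]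
    simp
  have hi1 : CircleIntegrable (fun w => Real.log (1 + ‖w‖)) z r :=
    (continuous_log_one_add_norm.comp (continuous_circleMap z r)).intervalIntegrable _ _
  have hi2 : CircleIntegrable (fun w => Real.log ‖w - c‖) z r :=
    MeromorphicOn.circleIntegrable_log_norm (fun w _ => by fun_prop)
  have hi3 : CircleIntegrable (fun w => Real.log (1 + ‖w‖) - Real.log ‖w - c‖) z r := hi1.sub hi2
  have hnn : ∀ w, 0 ≤ Real.log (1 + ‖w‖) - Real.log ‖w - c‖ := fun w =>
    sub_nonneg.2 (log_norm_sub_le hc)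
  have h1 : ∫⁻ θ in Ioc 0 (2 * Real.pi), logKernel (circleMap z r θ) c =
      ENNReal.ofReal (2 * Real.pi *
        Real.circleAverage (fun w => Real.log (1 + ‖w‖) - Real.log ‖w - c‖) z r) := by
    rw [← integral_circleMap_eq_circleAverage, ofReal_integral_eq_lintegral_ofReal
      ((intervalIntegrable_iff_integrableOn_Ioc_of_le Real.two_pi_pos.le).1 hi3)
      (Eventually.of_forall fun θ => hnn _)]
    refine lintegral_congr_ae ?_
    filter_upwards [ae_circleMap_ne z c hr] with θ hθ
    exact logKernel_of_ne hθ
  have h0 : 0 ≤ Real.log (1 + ‖z‖) := Real.log_nonneg (by linarith [norm_nonneg z])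
  have h2 := log_norm_sub_le_circleAverage hzc hr
  have hav : 0 ≤ Real.circleAverage (fun w => Real.log (1 + ‖w‖)) z r :=
    Real.circleAverage_nonneg_of_nonneg fun w _ => Real.log_nonneg (by linarith [norm_nonneg w])
  rw [h1, logKernel_of_ne hzc, ← ENNReal.ofReal_mul Real.two_pi_pos.le,
    Real.circleAverage_fun_sub hi1 hi2,
    Real.circleAverage_fun_add hi1 (circleIntegrable_const _ _ _), Real.circleAverage_const,
    ← ENNReal.ofReal_add, ← ENNReal.ofReal_add]
  · refine ENNReal.ofReal_le_ofReal ?_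
    have := Real.two_pi_pos
    nlinarith
  · exact mul_nonneg Real.two_pi_pos.le (by linarith)
  · exact mul_nonneg Real.two_pi_pos.le (hnn z)
  · rw [← Real.circleAverage_fun_sub hi1 hi2]
    exact mul_nonneg Real.two_pi_pos.le (Real.circleAverage_nonneg_of_nonneg fun w _ => hnn w)
  · exact mul_nonneg Real.two_pi_pos.le (by linarith)

/-- The sum `∑ j, 2^{-(j+1)} (log (1 + |z|) - log |z - c j|)`. -/
def logKernelSum (c : ℕ → ℂ) (z : ℂ) : ENNReal :=
  ∑' j : ℕ, 2⁻¹ ^ (j + 1) * logKernel z (c j)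

/-- The function `M + ∑ j, 2^{-(j+1)} log |z - c j|`, written as
`log (1 + |z|) + M - logKernelSum c z` so that the series has nonnegative terms. -/
def atomicPotential (c : ℕ → ℂ) (M : ℝ) (z : ℂ) : EReal :=
  ((Real.log (1 + ‖z‖) + M : ℝ) : EReal) - (logKernelSum c z : EReal)

theorem tsum_inv_two_pow_succ : ∑' j : ℕ, (2⁻¹ : ENNReal) ^ (j + 1) = 1 := by
  simp_rw [pow_succ']
  rw [ENNReal.tsum_mul_left, ENNReal.tsum_geometric, ENNReal.one_sub_inv_two, inv_inv]
  exact ENNReal.inv_mul_cancel (by simp) (by simp)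

/-- The kernel inequality summed against the weights `2^{-(j+1)}`; their total mass is one, so that
the terms without the kernel are reproduced exactly. -/
theorem lintegral_logKernelSum_add_le {c : ℕ → ℂ} (hc : ∀ j, ‖c j‖ ≤ 1) (z : ℂ) {r : ℝ}
    (hr : 0 < r) {M : ℝ} (hM : 0 ≤ M) :
    (∫⁻ θ in Ioc 0 (2 * Real.pi), logKernelSum c (circleMap z r θ)) +
        ENNReal.ofReal (2 * Real.pi * (Real.log (1 + ‖z‖) + M)) ≤
      ENNReal.ofReal (2 * Real.pi *
        Real.circleAverage (fun w => Real.log (1 + ‖w‖) + M) z r) +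
        ENNReal.ofReal (2 * Real.pi) * logKernelSum c z := by
  have hm : ∀ j, Measurable fun θ : ℝ => logKernel (circleMap z r θ) (c j) := fun j =>
    ((continuous_logKernel (c j)).comp (continuous_circleMap z r)).measurable
  have h : ∀ a : ENNReal, a = ∑' j : ℕ, 2⁻¹ ^ (j + 1) * a := fun a => by
    rw [ENNReal.tsum_mul_right, tsum_inv_two_pow_succ, one_mul]
  unfold logKernelSum
  rw [lintegral_tsum fun j => ((hm j).const_mul _).aemeasurable, ← ENNReal.tsum_mul_left,
    h (ENNReal.ofReal (2 * Real.pi * (Real.log (1 + ‖z‖) + M))),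
    h (ENNReal.ofReal (2 * Real.pi * Real.circleAverage (fun w => Real.log (1 + ‖w‖) + M) z r)),
    ← ENNReal.tsum_add, ← ENNReal.tsum_add]
  refine ENNReal.tsum_le_tsum fun j => ?_
  rw [lintegral_const_mul _ (hm j), mul_left_comm (ENNReal.ofReal (2 * Real.pi)), ← mul_add,
    ← mul_add]
  refine mul_le_mul_right ?_ _
  exact lintegral_logKernel_add_le (hc j) hr hM

theorem atomicPotential_le (c : ℕ → ℂ) (M : ℝ) (z : ℂ) :
    atomicPotential c M z ≤ ((Real.log (1 + ‖z‖) + M : ℝ) : EReal) :=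
  EReal.sub_le_of_le_add (le_add_of_nonneg_right (EReal.coe_ennreal_nonneg _))

theorem upperSemicontinuous_atomicPotential (c : ℕ → ℂ) (M : ℝ) :
    UpperSemicontinuous (atomicPotential c M) := by
  have hS : LowerSemicontinuous (logKernelSum c) := lowerSemicontinuous_tsum fun j =>
    ((ENNReal.continuous_const_mul (by finiteness)).comp
      (continuous_logKernel (c j))).lowerSemicontinuous
  have hS' : UpperSemicontinuous fun z => -(logKernelSum c z : EReal) := by
    have := (continuous_neg.comp continuous_coe_ennreal_ereal).comp_lowerSemicontinuous_antitone
      hS (fun a b hab => by simpa using hab)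
    exact this
  unfold atomicPotential
  simp_rw [sub_eq_add_neg]
  refine UpperSemicontinuous.add' (Continuous.upperSemicontinuous ?_) hS' fun z => ?_
  · exact continuous_coe_real_ereal.comp (continuous_log_one_add_norm.add continuous_const)
  · exact EReal.continuousAt_add (Or.inl (EReal.coe_ne_top _)) (Or.inl (EReal.coe_ne_bot _))

theorem isSubharmonicOn_atomicPotential {c : ℕ → ℂ} (hc : ∀ j, ‖c j‖ ≤ 1) {M : ℝ} (hM : 0 ≤ M) :
    IsSubharmonicOn (atomicPotential c M) univ where
  ne_top z _ := ((atomicPotential_le c M z).trans_lt (EReal.coe_lt_top _)).ne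
  usc := (upperSemicontinuous_atomicPotential c M).upperSemicontinuousOn _
  submean z r hr _ := by
    have hcont : Continuous fun θ => Real.log (1 + ‖circleMap z r θ‖) + M :=
      (continuous_log_one_add_norm.comp (continuous_circleMap z r)).add continuous_const
    have hi : CircleIntegrable (fun w : ℂ => Real.log (1 + ‖w‖) + M) z r :=
      hcont.intervalIntegrable _ _
    have hmeas : Measurable fun θ : ℝ => atomicPotential c M (circleMap z r θ) :=
      (upperSemicontinuous_atomicPotential c M).measurable.comp
        (continuous_circleMap z r).measurable
    rw [erealIntegral_eq_sub_lintegral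
      (g := fun θ => (fun w : ℂ => Real.log (1 + ‖w‖) + M) (circleMap z r θ))
      hmeas ((intervalIntegrable_iff_integrableOn_Ioc_of_le Real.two_pi_pos.le).1 hi)
      (fun θ => atomicPotential_le c M _),
      integral_circleMap_eq_circleAverage (fun w : ℂ => Real.log (1 + ‖w‖) + M) z r]
    have hgap : ∀ w : ℂ, (((Real.log (1 + ‖w‖) + M : ℝ) : EReal) -
        atomicPotential c M w).toENNReal = logKernelSum c w := by
      intro w
      unfold atomicPotential
      generalize logKernelSum c w = S
      induction S with
      | top => simp
      | coe S =>
        have e : (((S : ENNReal) : EReal)) = ((S : ℝ) : EReal) := rfl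
        rw [e, ← EReal.coe_sub, ← EReal.coe_sub, sub_sub_cancel, ← e, EReal.toENNReal_coe]
    simp_rw [hgap]
    have key := lintegral_logKernelSum_add_le hc z hr hM
    unfold atomicPotential
    generalize (∫⁻ θ in Ioc 0 (2 * Real.pi), logKernelSum c (circleMap z r θ)) = L at *
    generalize logKernelSum c z = S at *
    have hA : 0 ≤ Real.circleAverage (fun w => Real.log (1 + ‖w‖) + M) z r :=
      Real.circleAverage_nonneg_of_nonneg fun w _ =>
        add_nonneg (Real.log_nonneg (by linarith [norm_nonneg w])) hM
    generalize Real.circleAverage (fun w => Real.log (1 + ‖w‖) + M) z r = A at *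
    have hB : 0 ≤ Real.log (1 + ‖z‖) + M :=
      add_nonneg (Real.log_nonneg (by linarith [norm_nonneg z])) hM
    generalize Real.log (1 + ‖z‖) + M = B at *
    induction S with
    | top => simp
    | coe S =>
      have hL : L ≠ ⊤ := by
        rintro rfl
        simp [ENNReal.mul_eq_top] at key
      lift L to NNReal using hL
      have key' : (L : ℝ) + 2 * Real.pi * B ≤ 2 * Real.pi * A + 2 * Real.pi * S := by
        have h2 := ENNReal.toReal_mono (by finiteness) key
        rw [ENNReal.toReal_add (by finiteness) (by finiteness),
          ENNReal.toReal_add (by finiteness) (by finiteness), ENNReal.toReal_mul,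
          ENNReal.toReal_ofReal (by positivity), ENNReal.toReal_ofReal (by positivity),
          ENNReal.toReal_ofReal (by positivity)] at h2
        exact h2
      have e : ∀ t : NNReal, (((t : ENNReal) : EReal)) = ((t : ℝ) : EReal) := fun _ => rfl
      rw [e, e, ← EReal.coe_sub, ← EReal.coe_sub, ← EReal.coe_mul, EReal.coe_le_coe_iff,
        le_inv_mul_iff₀ Real.two_pi_pos]
      linarith

theorem atomicPotential_mem_lelongClass {c : ℕ → ℂ} (hc : ∀ j, ‖c j‖ ≤ 1) {M : ℝ} (hM : 0 ≤ M) :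
    atomicPotential c M ∈ lelongClass := by
  refine ⟨isSubharmonicOn_atomicPotential hc hM, Real.log 2 + M, ?_⟩
  rw [← Metric.cobounded_eq_cocompact, (hasBasis_cobounded_norm).eventually_iff]
  refine ⟨1, trivial, fun z hz => (atomicPotential_le c M z).trans ?_⟩
  have hz : 1 ≤ ‖z‖ := hz
  rw [EReal.coe_le_coe_iff, ← add_assoc, ← Real.log_mul (by positivity) (by norm_num)]
  gcongr
  linarith

/-- Closeness to one of the points `c j`, exponential in the inverse of the weight, makes the
potential nonpositive. -/
theorem atomicPotential_nonpos {c : ℕ → ℂ} {M : ℝ} (hM : 0 ≤ M) {z : ℂ}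
    (hdist : ∀ j, ‖z - c j‖ ≤ 1) {i : ℕ} (hi : ‖z - c i‖ ≤ Real.exp (-(2 ^ (i + 1) * M))) :
    atomicPotential c M z ≤ 0 := by
  have hlog0 : 0 ≤ Real.log (1 + ‖z‖) := Real.log_nonneg (by linarith [norm_nonneg z])
  suffices h : ENNReal.ofReal (Real.log (1 + ‖z‖) + M) ≤ logKernelSum c z by
    unfold atomicPotential
    refine EReal.sub_nonpos.2 ?_
    have h2 := EReal.coe_ennreal_le_coe_ennreal_iff.2 h
    rwa [EReal.coe_ennreal_ofReal, max_eq_left (by positivity)] at h2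
  -- Together the terms contribute at least `log (1 + |z|)`, and the `i`-th one a further `M`.
  have hterm : ∀ j, (2⁻¹ : ENNReal) ^ (j + 1) * ENNReal.ofReal (Real.log (1 + ‖z‖)) +
      (if j = i then ENNReal.ofReal M else 0) ≤ 2⁻¹ ^ (j + 1) * logKernel z (c j) := by
    intro j
    split_ifs with hji
    · subst hji
      have h1 : ENNReal.ofReal M = 2⁻¹ ^ (j + 1) * ENNReal.ofReal (2 ^ (j + 1) * M) := by
        rw [ENNReal.ofReal_mul (by positivity), ENNReal.ofReal_pow (by norm_num), ← mul_assoc,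
          ← mul_pow, ENNReal.ofReal_ofNat, ENNReal.inv_mul_cancel (by simp) (by simp), one_pow,
          one_mul]
      rw [h1, ← mul_add, ← ENNReal.ofReal_add hlog0 (by positivity)]
      gcongr
      refine ofReal_le_logKernel fun hne => ?_
      have h2 := Real.log_le_log (norm_pos_iff.2 (sub_ne_zero.2 hne)) hi
      rw [Real.log_exp] at h2
      linarith
    · rw [add_zero]
      gcongr
      refine ofReal_le_logKernel fun hne => ?_
      have := Real.log_nonpos (norm_nonneg _) (hdist j)
      linarith
  calc ENNReal.ofReal (Real.log (1 + ‖z‖) + M)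
      = ∑' j : ℕ, ((2⁻¹ : ENNReal) ^ (j + 1) * ENNReal.ofReal (Real.log (1 + ‖z‖)) +
          (if j = i then ENNReal.ofReal M else 0)) := by
        rw [ENNReal.tsum_add, ENNReal.tsum_mul_right, tsum_inv_two_pow_succ, one_mul,
          tsum_ite_eq, ENNReal.ofReal_add hlog0 hM]
    _ ≤ logKernelSum c z := ENNReal.tsum_le_tsum hterm

theorem le_atomicPotential_two {c : ℕ → ℂ} (hc : ∀ j, ‖c j‖ ≤ 1) (M : ℝ) :
    (M : EReal) ≤ atomicPotential c M 2 := by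
  have h : logKernelSum c 2 ≤ ENNReal.ofReal (Real.log (1 + ‖(2 : ℂ)‖)) := by
    calc logKernelSum c 2 ≤
        ∑' j : ℕ, (2⁻¹ : ENNReal) ^ (j + 1) * ENNReal.ofReal (Real.log (1 + ‖(2 : ℂ)‖)) := by
          refine ENNReal.tsum_le_tsum fun j => ?_
          gcongr
          have h1 : 1 ≤ ‖2 - c j‖ := by
            have := norm_sub_norm_le 2 (c j)
            rw [Complex.norm_ofNat] at this
            linarith [hc j]
          rw [logKernel_of_ne]
          · exact ENNReal.ofReal_le_ofReal (sub_le_self _ (Real.log_nonneg h1))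
          · intro h2
            rw [← h2] at h1
            norm_num at h1
      _ = _ := by rw [ENNReal.tsum_mul_right, tsum_inv_two_pow_succ, one_mul]
  have h0 : 0 ≤ Real.log (1 + ‖(2 : ℂ)‖) := Real.log_nonneg (by linarith [norm_nonneg (2 : ℂ)])
  have h2 := EReal.coe_ennreal_le_coe_ennreal_iff.2 h
  rw [EReal.coe_ennreal_ofReal, max_eq_left h0] at h2
  calc (M : EReal) = ((Real.log (1 + ‖(2 : ℂ)‖) + M : ℝ) : EReal) -
        ((Real.log (1 + ‖(2 : ℂ)‖) : ℝ) : EReal) := by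
        rw [← EReal.coe_sub, add_sub_cancel_left]
    _ ≤ _ := EReal.sub_le_sub le_rfl h2

/-! ### The radii of the intervals and the capacity of their union -/

/-- The radii `ε n`. The exponent dominates `4 ^ (j + 4)` for every code `j = Nat.pair n k` of an
interval of the `n`-th generation, `k < n ^ 3`. -/
def totikRadius (n : ℕ) : ℝ :=
  Real.exp (-(4 ^ (Nat.pair n (n ^ 3) + 4)))

/-- The mesh points `k / n ^ 3`, enumerated by the code `j = Nat.pair n k`; codes that do not
correspond to an interval give the point `0`. -/
def meshPoint (j : ℕ) : ℝ :=
  if j.unpair.2 < j.unpair.1 ^ 3 then (j.unpair.2 : ℝ) / (j.unpair.1 : ℝ) ^ 3 else 0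

theorem totikRadius_pos (n : ℕ) : 0 < totikRadius n := Real.exp_pos _

theorem totikRadius_le_exp {n k : ℕ} (hk : k < n ^ 3) :
    totikRadius n ≤ Real.exp (-(4 ^ (Nat.pair n k + 4))) := by
  have h : Nat.pair n k ≤ Nat.pair n (n ^ 3) := (Nat.pair_lt_pair_right n hk).le
  unfold totikRadius
  gcongr
  norm_num

theorem totikRadius_le {n : ℕ} (hn : 1 ≤ n) : totikRadius n ≤ 1 / (n : ℝ) ^ 3 := by
  have h1 : n ^ 3 ≤ 4 ^ (Nat.pair n (n ^ 3) + 4) :=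
    calc n ^ 3 ≤ Nat.pair n (n ^ 3) := Nat.right_le_pair _ _
      _ ≤ Nat.pair n (n ^ 3) + 4 := Nat.le_add_right _ _
      _ ≤ 4 ^ (Nat.pair n (n ^ 3) + 4) := (Nat.lt_pow_self (by norm_num)).le
  have h2 : (n : ℝ) ^ 3 ≤ 4 ^ (Nat.pair n (n ^ 3) + 4) := by exact_mod_cast h1
  have hn' : (0 : ℝ) < n := by exact_mod_cast hn
  rw [totikRadius, Real.exp_neg, ← one_div]
  refine one_div_le_one_div_of_le (by positivity) (h2.trans ?_)
  linarith [Real.add_one_le_exp ((4 : ℝ) ^ (Nat.pair n (n ^ 3) + 4))]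

theorem smallInterval_subset_Icc {ε : ℝ} {n k : ℕ} (hε : ε ≤ 1 / (n : ℝ) ^ 3)
    (hk : k ∈ Finset.Ico 1 (n ^ 3)) : smallInterval ε n k ⊆ Icc 0 1 := by
  rw [Finset.mem_Ico] at hk
  have hn : (0 : ℝ) < (n : ℝ) ^ 3 := by exact_mod_cast (by omega : 0 < n ^ 3)
  have h1 : 1 / (n : ℝ) ^ 3 ≤ k / (n : ℝ) ^ 3 := by
    gcongr
    exact_mod_cast hk.1
  have h2 : (k : ℝ) / (n : ℝ) ^ 3 + 1 / (n : ℝ) ^ 3 ≤ 1 := by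
    rw [← add_div, div_le_one hn]
    exact_mod_cast hk.2
  intro x hx
  exact ⟨by linarith [hx.1], by linarith [hx.2]⟩

theorem mem_totikSet {ε : ℕ → ℝ} {z : ℂ} : z ∈ totikSet ε ↔ ∃ n k : ℕ, 1 ≤ n ∧
    k ∈ Finset.Ico 1 (n ^ 3) ∧ ∃ x ∈ smallInterval (ε n) n k, (x : ℂ) = z := by
  simp only [totikSet, mem_image, mem_iUnion, mem_Ici, exists_prop]
  constructor
  · rintro ⟨x, ⟨n, hn, k, hk, hx⟩, rfl⟩
    exact ⟨n, k, hn, hk, x, hx, rfl⟩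
  · rintro ⟨n, k, hn, hk, x, hx, rfl⟩
    exact ⟨x, ⟨n, hn, k, hk, hx⟩, rfl⟩

theorem totikSet_subset_unitSegment : totikSet totikRadius ⊆ unitSegment := by
  intro z hz
  obtain ⟨n, k, hn, hk, x, hx, rfl⟩ := mem_totikSet.1 hz
  exact ⟨x, smallInterval_subset_Icc (totikRadius_le hn) hk hx, rfl⟩

theorem meshPoint_pair {n k : ℕ} (hk : k < n ^ 3) :
    meshPoint (Nat.pair n k) = (k : ℝ) / (n : ℝ) ^ 3 := by
  simp [meshPoint, hk]

theorem meshPoint_mem_Icc (j : ℕ) : meshPoint j ∈ Icc (0 : ℝ) 1 := by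
  unfold meshPoint
  split_ifs with h
  · refine ⟨by positivity, div_le_one_of_le₀ ?_ (by positivity)⟩
    exact_mod_cast h.le
  · simp

/-- Every point of the carrier lies in the disc around some `meshPoint j` whose radius is
doubly exponentially small in the code `j`. -/
theorem exists_norm_sub_meshPoint_le {z : ℂ} (hz : z ∈ totikSet totikRadius) :
    ∃ j : ℕ, ‖z - meshPoint j‖ ≤ Real.exp (-(4 ^ (j + 4))) := by
  obtain ⟨n, k, hn, hk, x, hx, rfl⟩ := mem_totikSet.1 hz
  have hk2 := (Finset.mem_Ico.1 hk).2
  refine ⟨Nat.pair n k, ?_⟩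
  rw [meshPoint_pair hk2, ← Complex.ofReal_sub, Complex.norm_real, Real.norm_eq_abs]
  refine le_trans ?_ (totikRadius_le_exp hk2)
  rw [abs_le]
  constructor <;> linarith [hx.1, hx.2]

theorem edist_le_one_of_mem_unitSegment {z w : ℂ} (hz : z ∈ unitSegment) (hw : w ∈ unitSegment) :
    edist z w ≤ 1 := by
  obtain ⟨x, hx, rfl⟩ := hz
  obtain ⟨y, hy, rfl⟩ := hw
  rw [edist_dist, Complex.dist_eq, ← Complex.ofReal_sub, Complex.norm_real, Real.norm_eq_abs,
    ← ENNReal.ofReal_one]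
  refine ENNReal.ofReal_le_ofReal (abs_le.2 ?_)
  constructor <;> linarith [hx.1, hx.2, hy.1, hy.2]

/-- If almost all pairs of points have distance at most one, the energy is at least the contribution
`L ν(A)²` of the pairs of points in a set `A` of diameter at most `e^{-L}`. -/
theorem le_logEnergy {ν : Measure ℂ} [SFinite ν] (hν : ∀ᵐ q ∂ν.prod ν, edist q.1 q.2 ≤ 1)
    {A : Set ℂ} (hA : MeasurableSet A) {L : ℝ}
    (hd : ∀ z ∈ A, ∀ w ∈ A, edist z w ≤ ENNReal.ofReal (Real.exp (-L))) :
    ((ENNReal.ofReal L * (ν A * ν A) : ENNReal) : EReal) ≤ logEnergy ν := by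
  have hneg : ∫⁻ q, (-(-ENNReal.log (edist q.1 q.2))).toENNReal ∂ν.prod ν = 0 := by
    rw [lintegral_eq_zero_iff' (by fun_prop)]
    filter_upwards [hν] with q hq
    exact EReal.toENNReal_of_nonpos (by simpa using ENNReal.log_le_zero_iff.2 hq)
  rw [logEnergy, erealIntegral, hneg, EReal.coe_ennreal_zero, sub_zero,
    EReal.coe_ennreal_le_coe_ennreal_iff]
  calc ENNReal.ofReal L * (ν A * ν A) = ∫⁻ q in A ×ˢ A, ENNReal.ofReal L ∂ν.prod ν := by
        rw [setLIntegral_const, Measure.prod_prod]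
    _ ≤ ∫⁻ q in A ×ˢ A, (-ENNReal.log (edist q.1 q.2)).toENNReal ∂ν.prod ν := by
        refine setLIntegral_mono' (hA.prod hA) fun q hq => ?_
        have h1 := ENNReal.log_monotone (hd q.1 hq.1 q.2 hq.2)
        rw [ENNReal.log_ofReal_of_pos (Real.exp_pos _), Real.log_exp] at h1
        have h2 := EReal.toENNReal_le_toENNReal (EReal.neg_le_neg_iff.2 h1)
        rwa [← EReal.coe_neg, neg_neg, EReal.toENNReal_of_ne_top (EReal.coe_ne_top _),
          EReal.toReal_coe] at h2
    _ ≤ _ := setLIntegral_le_lintegral _ _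

/-- A probability measure carried by the union of the intervals gives mass at least `2^{-(j+2)}` to
the `j`-th one for some `j`, and the length of that interval is tiny compared with this mass. -/
theorem three_le_logEnergy {K : Set ℂ} (hK : K ⊆ totikSet totikRadius) {ν : Measure ℂ}
    [IsProbabilityMeasure ν] (hν : ν Kᶜ = 0) : (3 : EReal) ≤ logEnergy ν := by
  have hKae : ∀ᵐ z ∂ν, z ∈ K := mem_ae_iff.2 hν
  set A : ℕ → Set ℂ := fun j => Metric.closedBall (meshPoint j : ℂ) (Real.exp (-(4 ^ (j + 4))))
    with hA
  obtain ⟨j, hj⟩ : ∃ j, (2⁻¹ : ENNReal) ^ (j + 2) ≤ ν (A j) := by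
    by_contra! hcon
    have h1 : (1 : ENNReal) ≤ 2⁻¹ :=
      calc 1 = ν univ := measure_univ.symm
        _ ≤ ν (⋃ j, A j) := by
          refine measure_mono_ae ?_
          filter_upwards [hKae] with z hz _
          obtain ⟨j, hj⟩ := exists_norm_sub_meshPoint_le (hK hz)
          exact mem_iUnion.2 ⟨j, by rwa [hA, Metric.mem_closedBall, dist_eq_norm]⟩
        _ ≤ ∑' j, ν (A j) := measure_iUnion_le _
        _ ≤ ∑' j : ℕ, 2⁻¹ * (2⁻¹ : ENNReal) ^ (j + 1) :=
          ENNReal.tsum_le_tsum fun j => by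
            rw [← pow_succ']
            exact (hcon j).le
        _ = 2⁻¹ := by rw [ENNReal.tsum_mul_left, tsum_inv_two_pow_succ, mul_one]
    exact absurd h1 (not_le.2 (ENNReal.inv_lt_one.2 (by norm_num)))
  have hdist : ∀ᵐ q ∂ν.prod ν, edist q.1 q.2 ≤ 1 := by
    filter_upwards [Measure.quasiMeasurePreserving_fst.ae hKae,
      Measure.quasiMeasurePreserving_snd.ae hKae] with q h1 h2
    exact edist_le_one_of_mem_unitSegment (totikSet_subset_unitSegment (hK h1))
      (totikSet_subset_unitSegment (hK h2))
  have hd : ∀ z ∈ A j, ∀ w ∈ A j, edist z w ≤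
      ENNReal.ofReal (Real.exp (-((4 : ℝ) ^ (j + 4) - 1))) := by
    intro z hz w hw
    rw [edist_dist]
    refine ENNReal.ofReal_le_ofReal ?_
    have h1 := dist_triangle_right z w (meshPoint j : ℂ)
    rw [hA, Metric.mem_closedBall] at hz hw
    have h2 : Real.exp (-((4 : ℝ) ^ (j + 4) - 1)) =
        Real.exp 1 * Real.exp (-(4 : ℝ) ^ (j + 4)) := by
      rw [← Real.exp_add]
      ring_nf
    rw [h2]
    -- The factor `e > 2` absorbs the passage from radius to diameter.
    have h3 := Real.exp_one_gt_d9
    have h4 := Real.exp_pos (-(4 : ℝ) ^ (j + 4))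
    nlinarith
  refine le_trans ?_ (le_logEnergy hdist Metric.isClosed_closedBall.measurableSet hd)
  have h3 : (3 : EReal) = ((3 : ENNReal) : EReal) := rfl
  rw [h3, EReal.coe_ennreal_le_coe_ennreal_iff]
  have hp : (2⁻¹ : ENNReal) ^ (j + 2) = ENNReal.ofReal ((1 / 2) ^ (j + 2)) := by
    rw [ENNReal.ofReal_pow (by norm_num), one_div, ENNReal.ofReal_inv_of_pos (by norm_num),
      ENNReal.ofReal_ofNat]
  have h4 : (1 : ℝ) ≤ 4 ^ (j + 2) := one_le_pow₀ (by norm_num)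
  calc (3 : ENNReal) = ENNReal.ofReal 3 := by simp
    _ ≤ ENNReal.ofReal (((4 : ℝ) ^ (j + 4) - 1) * ((1 / 2) ^ (j + 2) * (1 / 2) ^ (j + 2))) := by
        refine ENNReal.ofReal_le_ofReal ?_
        rw [← mul_pow, show (1 / 2 * (1 / 2) : ℝ) = 1 / 4 by norm_num, one_div_pow, mul_one_div,
          le_div_iff₀ (by positivity), pow_add, pow_add]
        rw [pow_add] at h4
        linarith
    _ = ENNReal.ofReal ((4 : ℝ) ^ (j + 4) - 1) * (2⁻¹ ^ (j + 2) * 2⁻¹ ^ (j + 2)) := by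
        rw [hp, ENNReal.ofReal_mul', ENNReal.ofReal_mul] <;> positivity
    _ ≤ _ := by gcongr

theorem logCapacity_totikSet_lt : logCapacity (totikSet totikRadius) < 1 / 8 := by
  have h : logCapacity (totikSet totikRadius) ≤ EReal.exp ((-3 : ℝ) : EReal) := by
    refine iSup₂_le fun K hK => EReal.exp_monotone ?_
    rw [EReal.coe_neg, EReal.neg_le_neg_iff]
    exact le_iInf₂ fun ν hν => by
      have := hν.1
      exact three_le_logEnergy hK.2 hν.2
  refine h.trans_lt ?_
  have h8 : (1 / 8 : ENNReal) = ENNReal.ofReal (1 / 8) := by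
    rw [ENNReal.ofReal_div_of_pos (by norm_num)]
    simp
  rw [EReal.exp_coe, h8]
  refine (ENNReal.ofReal_lt_ofReal_iff (by norm_num)).2 ?_
  rw [Real.exp_neg, ← one_div]
  refine one_div_lt_one_div_of_lt (by norm_num) ?_
  have h1 := Real.exp_one_gt_d9
  have h2 : Real.exp 3 = Real.exp 1 ^ 3 := by rw [← Real.exp_nat_mul]; norm_num
  rw [h2]
  calc (8 : ℝ) < 2.7 ^ 3 := by norm_num
    _ ≤ _ := by gcongr; linarith

/-! ### Markov's inequality and polynomials near their maximum -/

open Polynomial in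
/-- Markov's inequality at the endpoint `1` of `[-1, 1]`. -/
theorem eval_derivative_one_le {q : ℝ[X]} {n : ℕ} (hq : q.natDegree ≤ n) {M : ℝ} (hM : 0 < M)
    (hb : ∀ x ∈ Icc (-1 : ℝ) 1, |q.eval x| ≤ M) : q.derivative.eval 1 ≤ n ^ 2 * M := by
  have h := Chebyshev.eval_iterate_derivative_le_of_forall_abs_le_one (n := n)
    (P := C M⁻¹ * q) (k := 1) (x := 1) le_rfl
    ((natDegree_le_iff_degree_le).1 ((natDegree_C_mul_le _ _).trans hq)) fun x hx => by
      rw [eval_C_mul, abs_mul, abs_of_pos (inv_pos.2 hM), inv_mul_le_one₀ hM]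
      exact hb x hx
  simp only [Function.iterate_one, derivative_C_mul, eval_C_mul] at h
  rw [inv_mul_le_iff₀ hM] at h
  have hT : (derivative (Chebyshev.T ℝ n)).eval 1 = (n : ℝ) ^ 2 := by
    rw [Chebyshev.T_derivative_eq_U, eval_mul, Chebyshev.U_eval_one]
    simp [sq]
  rw [hT] at h
  linarith

open Polynomial in
/-- Markov's inequality at the points of the right half of `[0, 1]`, up to a constant: the segment
`[0, x]`, of length at least `1 / 2`, is rescaled to `[-1, 1]` so that `x` becomes the endpoint. -/
theorem eval_derivative_le_on_Icc {q : ℝ[X]} {n : ℕ} (hq : q.natDegree ≤ n) {M : ℝ} (hM : 0 < M)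
    (hb : ∀ x ∈ Icc (0 : ℝ) 1, |q.eval x| ≤ M) {x : ℝ} (hx : x ∈ Icc (1 / 2 : ℝ) 1) :
    |q.derivative.eval x| ≤ 4 * n ^ 2 * M := by
  have key : ∀ p : ℝ[X], p.natDegree ≤ n → (∀ x ∈ Icc (0 : ℝ) 1, |p.eval x| ≤ M) →
      p.derivative.eval x ≤ 4 * n ^ 2 * M := by
    intro p hp hpb
    have h := eval_derivative_one_le (q := p.comp (C (x / 2) * X + C (x / 2))) (n := n) ?_ hM ?_
    · rw [derivative_comp] at h
      simp only [derivative_add, derivative_C_mul, derivative_X, derivative_C, eval_mul, eval_comp,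
        eval_add, eval_C, eval_X, mul_one, add_zero, add_halves] at h
      have : 0 ≤ (n : ℝ) ^ 2 * M := by positivity
      nlinarith [hx.1, hx.2]
    · rw [natDegree_comp]
      calc _ ≤ p.natDegree * 1 := by
            gcongr
            exact natDegree_linear_le
        _ ≤ n := by simpa using hp
    · intro t ht
      rw [eval_comp]
      refine hpb _ ?_
      simp only [eval_add, eval_mul, eval_C, eval_X]
      constructor <;> nlinarith [hx.1, hx.2, ht.1, ht.2]
  rw [abs_le']
  refine ⟨key q hq hb, ?_⟩
  have := key (-q) (by simpa using hq) (by simpa using hb)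
  simpa using this

open Polynomial in
theorem abs_eval_derivative_le_of_mem_Icc {q : ℝ[X]} {n : ℕ} (hq : q.natDegree ≤ n) {M : ℝ}
    (hM : 0 < M) (hb : ∀ x ∈ Icc (0 : ℝ) 1, |q.eval x| ≤ M) {x : ℝ} (hx : x ∈ Icc (0 : ℝ) 1) :
    |q.derivative.eval x| ≤ 4 * n ^ 2 * M := by
  rcases le_total (1 / 2) x with h | h
  · exact eval_derivative_le_on_Icc hq hM hb ⟨h, hx.2⟩
  · have h1 := eval_derivative_le_on_Icc (q := q.comp (1 - X)) (n := n) (x := 1 - x) ?_ hM ?_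
      ⟨by linarith, by linarith [hx.1]⟩
    · simpa [derivative_comp] using h1
    · rw [natDegree_comp]
      have : (1 - X : ℝ[X]).natDegree ≤ 1 := by compute_degree
      calc _ ≤ q.natDegree * 1 := by gcongr
        _ ≤ n := by simpa using hq
    · intro t ht
      simp only [eval_comp, eval_sub, eval_one, eval_X]
      exact hb _ ⟨by linarith [ht.2], by linarith [ht.1]⟩

open Polynomial in
/-- The polynomial whose values at real points are the real parts of those of `p`. -/
def realPart (p : ℂ[X]) : ℝ[X] :=
  ∑ i ∈ Finset.range (p.natDegree + 1), monomial i (p.coeff i).re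

open Polynomial in
theorem natDegree_realPart_le (p : ℂ[X]) : (realPart p).natDegree ≤ p.natDegree := by
  refine natDegree_sum_le_of_forall_le _ _ fun i hi => (natDegree_monomial_le _).trans ?_
  simpa [Nat.lt_succ_iff] using hi

open Polynomial in
theorem eval_realPart (p : ℂ[X]) (x : ℝ) : (realPart p).eval x = (p.eval (x : ℂ)).re := by
  rw [realPart, eval_finsetSum, eval_eq_sum_range, Complex.re_sum]
  refine Finset.sum_congr rfl fun i _ => ?_
  rw [eval_monomial, ← Complex.ofReal_pow, Complex.re_mul_ofReal]

open Polynomial in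
/-- A polynomial of degree at most `n` keeps half of its maximum over `[0, 1]` at distance
`1 / (8 n²)` from a maximum point. -/
theorem norm_eval_ge_near_max {p : ℂ[X]} {n : ℕ} (hp : p.natDegree ≤ n) {x₀ : ℝ}
    (hx₀ : x₀ ∈ Icc (0 : ℝ) 1) (hmax : ∀ x ∈ Icc (0 : ℝ) 1, ‖p.eval (x : ℂ)‖ ≤ ‖p.eval (x₀ : ℂ)‖)
    {x : ℝ} (hx : x ∈ Icc (0 : ℝ) 1) (hd : 8 * (n : ℝ) ^ 2 * |x - x₀| ≤ 1) :
    ‖p.eval (x₀ : ℂ)‖ / 2 ≤ ‖p.eval (x : ℂ)‖ := by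
  rcases (norm_nonneg (p.eval (x₀ : ℂ))).eq_or_lt with h0 | hM
  · rw [← h0]
    simp
  set M := ‖p.eval (x₀ : ℂ)‖ with hMdef
  -- Rotating `p` makes its value at `x₀` equal to `M`.
  set c : ℂ := (starRingEnd ℂ) (p.eval (x₀ : ℂ)) / M with hc
  have hcn : ‖c‖ = 1 := by
    rw [hc, norm_div, Complex.norm_conj, Complex.norm_real, norm_norm, div_self hM.ne']
  set q := realPart (C c * p) with hq
  have hqd : q.natDegree ≤ n :=
    (natDegree_realPart_le _).trans ((natDegree_C_mul_le _ _).trans hp)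
  have hqle : ∀ y : ℝ, |q.eval y| ≤ ‖p.eval (y : ℂ)‖ := by
    intro y
    rw [hq, eval_realPart, eval_C_mul]
    refine (Complex.abs_re_le_norm _).trans ?_
    rw [norm_mul, hcn, one_mul]
  have hq0 : q.eval x₀ = M := by
    rw [hq, eval_realPart, eval_C_mul, hc, div_mul_eq_mul_div, Complex.conj_mul', ← hMdef,
      ← Complex.ofReal_pow, ← Complex.ofReal_div, Complex.ofReal_re]
    field_simp
  have hlip := (convex_Icc (0 : ℝ) 1).norm_image_sub_le_of_norm_deriv_le
    (f := fun y => q.eval y) (C := 4 * n ^ 2 * M) (fun y _ => q.differentiableAt)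
    (fun y hy => by
      rw [Polynomial.deriv, Real.norm_eq_abs]
      exact abs_eval_derivative_le_of_mem_Icc hqd hM
        (fun t ht => (hqle t).trans (hmax t ht)) hy) hx₀ hx
  rw [hq0, Real.norm_eq_abs, Real.norm_eq_abs] at hlip
  have h1 := (abs_le.1 hlip).1
  have h2 := (le_abs_self _).trans (hqle x)
  nlinarith

/-- Every point of `[0, 1]` is within one mesh width of an interior mesh point. -/
theorem exists_mesh_near {n : ℕ} (hn : 2 ≤ n) {x : ℝ} (hx : x ∈ Icc (0 : ℝ) 1) :
    ∃ k ∈ Finset.Ico 1 (n ^ 3), |(k : ℝ) / (n : ℝ) ^ 3 - x| ≤ 1 / (n : ℝ) ^ 3 := by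
  set N := n ^ 3 with hN
  have hN2 : 2 ≤ N := hn.trans (Nat.le_self_pow (by norm_num) n)
  have hNcast : (n : ℝ) ^ 3 = N := by rw [hN]; push_cast; rfl
  have hNpos : (0 : ℝ) < N := by exact_mod_cast (by omega : 0 < N)
  rw [hNcast]
  suffices h : ∃ k ∈ Finset.Ico 1 N, |(k : ℝ) - x * N| ≤ 1 by
    obtain ⟨k, hk, hd⟩ := h
    refine ⟨k, hk, ?_⟩
    rw [show (k : ℝ) / N - x = (k - x * N) / N by field_simp, abs_div, abs_of_pos hNpos]
    gcongr
  have hxN0 : 0 ≤ x * N := mul_nonneg hx.1 hNpos.le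
  have hxN1 : x * N ≤ N := mul_le_of_le_one_left hNpos.le hx.2
  rcases lt_or_ge (x * N) 1 with h1 | h1
  · refine ⟨1, by simp; omega, ?_⟩
    rw [abs_le]
    push_cast
    constructor <;> linarith
  rcases lt_or_ge (x * N) ((N - 1 : ℕ) : ℝ) with h2 | h2
  · have hfl := Nat.floor_le hxN0
    have hfl2 := Nat.lt_floor_add_one (x * N)
    refine ⟨⌊x * N⌋₊, ?_, ?_⟩
    · rw [Finset.mem_Ico]
      refine ⟨Nat.le_floor (by simpa using h1), ?_⟩
      have := hfl.trans_lt h2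
      have : ⌊x * N⌋₊ < N - 1 := by exact_mod_cast this
      omega
    · rw [abs_le]
      constructor <;> linarith
  · refine ⟨N - 1, by simp; omega, ?_⟩
    rw [Nat.cast_sub (by omega), Nat.cast_one] at h2 ⊢
    rw [abs_le]
    constructor <;> linarith

/-! ### The measure and its properties -/

theorem volume_smallInterval {ε : ℝ} (n k : ℕ) :
    volume (smallInterval ε n k) = ENNReal.ofReal (2 * ε) := by
  rw [smallInterval, Real.volume_Icc]
  congr 1
  ring

theorem measurableSet_smallInterval (ε : ℝ) (n k : ℕ) : MeasurableSet (smallInterval ε n k) :=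
  measurableSet_Icc

theorem le_spreadMeasure_smallInterval {ε : ℝ} (hε : 0 < ε) {n k : ℕ}
    (hk : k ∈ Finset.Ico 1 (n ^ 3)) :
    ENNReal.ofReal (2 / (n : ℝ) ^ 5) ≤ spreadMeasure ε n (smallInterval ε n k) := by
  rw [spreadMeasure, withDensity_apply _ (measurableSet_smallInterval ε n k)]
  calc ENNReal.ofReal (2 / (n : ℝ) ^ 5)
      = ∫⁻ _ in smallInterval ε n k, ENNReal.ofReal (1 / (n : ℝ) ^ 5 * (1 / ε)) := by
        rw [setLIntegral_const, volume_smallInterval, ← ENNReal.ofReal_mul (by positivity)]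
        congr 1
        field_simp
    _ ≤ _ := by
        refine setLIntegral_mono' (measurableSet_smallInterval ε n k) fun x hx =>
          ENNReal.ofReal_le_ofReal ?_
        gcongr
        calc 1 / ε = 1 / ε * (smallInterval ε n k).indicator (fun _ => (1 : ℝ)) x := by
              rw [indicator_of_mem hx, mul_one]
          _ ≤ _ := Finset.single_le_sum (f := fun k => 1 / ε *
              (smallInterval ε n k).indicator (fun _ => (1 : ℝ)) x) (fun i _ =>
                mul_nonneg (by positivity) (indicator_nonneg (fun _ _ => zero_le_one) x)) hk

theorem spreadMeasure_univ_le {ε : ℝ} (hε : 0 < ε) {n : ℕ} (hn : 1 ≤ n) :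
    spreadMeasure ε n univ ≤ ENNReal.ofReal (2 / (n : ℝ) ^ 2) := by
  have hn' : (0 : ℝ) < n := by exact_mod_cast hn
  have hind : ∀ k, Integrable ((smallInterval ε n k).indicator fun _ => (1 : ℝ)) := fun k =>
    (integrable_indicator_iff (measurableSet_smallInterval ε n k)).2
      (integrableOn_const (by rw [volume_smallInterval]; exact ENNReal.ofReal_ne_top))
  have hsum : Integrable fun x => 1 / (n : ℝ) ^ 5 * ∑ k ∈ Finset.Ico 1 (n ^ 3),
      1 / ε * (smallInterval ε n k).indicator (fun _ => (1 : ℝ)) x :=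
    (integrable_finsetSum _ fun k _ => (hind k).const_mul _).const_mul _
  rw [spreadMeasure, withDensity_apply _ MeasurableSet.univ, Measure.restrict_univ,
    ← ofReal_integral_eq_lintegral_ofReal hsum]
  · refine ENNReal.ofReal_le_ofReal ?_
    have hk : ∀ k, ∫ x, 1 / ε * (smallInterval ε n k).indicator (fun _ => (1 : ℝ)) x = 2 := by
      intro k
      rw [integral_const_mul, integral_indicator_const _ (measurableSet_smallInterval ε n k),
        Measure.real, volume_smallInterval, ENNReal.toReal_ofReal (by positivity), smul_eq_mul]
      field_simp
    rw [integral_const_mul, integral_finsetSum _ fun k _ => (hind k).const_mul _]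
    simp only [hk, Finset.sum_const, Nat.card_Ico, nsmul_eq_mul]
    have h1 : ((n ^ 3 - 1 : ℕ) : ℝ) ≤ (n : ℝ) ^ 3 := by exact_mod_cast Nat.sub_le _ _
    calc 1 / (n : ℝ) ^ 5 * (((n ^ 3 - 1 : ℕ) : ℝ) * 2) ≤ 1 / (n : ℝ) ^ 5 * ((n : ℝ) ^ 3 * 2) := by
          gcongr
      _ = _ := by field_simp
  · exact Eventually.of_forall fun x => mul_nonneg (by positivity)
      (Finset.sum_nonneg fun k _ => mul_nonneg (by positivity)
        (indicator_nonneg (fun _ _ => zero_le_one) x))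

theorem spreadMeasure_eq_zero_of_disjoint {ε : ℝ} {n : ℕ} {A : Set ℝ} (hA : MeasurableSet A)
    (hd : ∀ k ∈ Finset.Ico 1 (n ^ 3), Disjoint A (smallInterval ε n k)) :
    spreadMeasure ε n A = 0 := by
  rw [spreadMeasure, withDensity_apply _ hA, setLIntegral_congr_fun hA (g := fun _ => 0)]
  · simp
  · intro x hx
    have : ∀ k ∈ Finset.Ico 1 (n ^ 3),
        1 / ε * (smallInterval ε n k).indicator (fun _ => (1 : ℝ)) x = 0 := fun k hk => by
      rw [indicator_of_notMem (disjoint_left.1 (hd k hk) hx), mul_zero]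
    simp only
    rw [Finset.sum_eq_zero this]
    simp

theorem measurableEmbedding_complex_ofReal : MeasurableEmbedding fun x : ℝ => (x : ℂ) :=
  Complex.isometry_ofReal.isClosedEmbedding.measurableEmbedding

theorem totikMeasure_apply (ε : ℕ → ℝ) (A : Set ℂ) : totikMeasure ε A =
    (Measure.sum fun n : ℕ => spreadMeasure (ε (n + 1)) (n + 1))
      ((fun x : ℝ => (x : ℂ)) ⁻¹' A) :=
  measurableEmbedding_complex_ofReal.map_apply _ A

theorem totikMeasure_eq_zero_of_volume {ε : ℕ → ℝ} {A : Set ℂ}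
    (hA : volume ((fun x : ℝ => (x : ℂ)) ⁻¹' A) = 0) : totikMeasure ε A = 0 := by
  rw [totikMeasure_apply, Measure.sum_apply_eq_zero]
  exact fun n => withDensity_absolutelyContinuous _ _ hA

theorem le_totikMeasure {ε : ℕ → ℝ} (hε : ∀ n, 1 ≤ n → 0 < ε n) {n k : ℕ}
    (hk : k ∈ Finset.Ico 1 (n ^ 3)) {A : Set ℂ} (hA : ∀ x ∈ smallInterval (ε n) n k, (x : ℂ) ∈ A) :
    ENNReal.ofReal (2 / (n : ℝ) ^ 5) ≤ totikMeasure ε A := by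
  obtain _ | n := n
  · simp at hk
  calc _ ≤ spreadMeasure (ε (n + 1)) (n + 1) (smallInterval (ε (n + 1)) (n + 1) k) :=
        le_spreadMeasure_smallInterval (hε _ (Nat.le_add_left 1 n)) hk
    _ ≤ (Measure.sum fun n : ℕ => spreadMeasure (ε (n + 1)) (n + 1))
          (smallInterval (ε (n + 1)) (n + 1) k) := Measure.le_sum_apply _ _ |>.trans' <|
        ENNReal.le_tsum (f := fun m : ℕ => spreadMeasure (ε (m + 1)) (m + 1)
          (smallInterval (ε (n + 1)) (n + 1) k)) n
    _ ≤ totikMeasure ε A := by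
        rw [totikMeasure_apply]
        exact measure_mono hA

theorem isFiniteMeasure_totikMeasure {ε : ℕ → ℝ} (hε : ∀ n, 1 ≤ n → 0 < ε n) :
    IsFiniteMeasure (totikMeasure ε) := by
  refine ⟨?_⟩
  rw [totikMeasure_apply, preimage_univ, Measure.sum_apply _ MeasurableSet.univ]
  have hs : Summable fun n : ℕ => 2 / ((n + 1 : ℕ) : ℝ) ^ 2 := by
    have := (summable_nat_add_iff 1).2 (Real.summable_one_div_nat_pow.2 (by norm_num : 1 < 2))
    simpa [div_eq_mul_inv] using this.mul_left 2
  calc ∑' n : ℕ, spreadMeasure (ε (n + 1)) (n + 1) univ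
      ≤ ∑' n : ℕ, ENNReal.ofReal (2 / ((n + 1 : ℕ) : ℝ) ^ 2) :=
        ENNReal.tsum_le_tsum fun n =>
          spreadMeasure_univ_le (hε _ (Nat.le_add_left 1 n)) (Nat.le_add_left 1 n)
    _ = ENNReal.ofReal (∑' n : ℕ, 2 / ((n + 1 : ℕ) : ℝ) ^ 2) :=
        (ENNReal.ofReal_tsum_of_nonneg (fun n => by positivity) hs).symm
    _ < ⊤ := ENNReal.ofReal_lt_top

theorem measurableSet_totikSet (ε : ℕ → ℝ) : MeasurableSet (totikSet ε) :=
  measurableEmbedding_complex_ofReal.measurableSet_image.2 <|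
    MeasurableSet.biUnion (to_countable _) fun _ _ =>
      Finset.measurableSet_biUnion _ fun _ _ => measurableSet_smallInterval _ _ _

theorem totikMeasure_compl_totikSet (ε : ℕ → ℝ) : totikMeasure ε (totikSet ε)ᶜ = 0 := by
  rw [totikMeasure_apply, Measure.sum_apply_eq_zero]
  intro n
  refine spreadMeasure_eq_zero_of_disjoint
    (measurableEmbedding_complex_ofReal.measurable (measurableSet_totikSet ε).compl) fun k hk => ?_
  exact disjoint_left.2 fun x hx hx' =>
    hx (mem_totikSet.2 ⟨n + 1, k, Nat.le_add_left 1 n, hk, x, hx', rfl⟩)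

theorem isCarrier_totikSet :
    IsCarrier unitSegment (totikMeasure totikRadius) (totikSet totikRadius) := by
  refine ⟨measurableSet_totikSet _, totikSet_subset_unitSegment,
    le_antisymm (measure_mono totikSet_subset_unitSegment) ?_⟩
  calc _ ≤ totikMeasure totikRadius univ := measure_mono (subset_univ _)
    _ = totikMeasure totikRadius (totikSet totikRadius) := by
        rw [← measure_add_measure_compl (measurableSet_totikSet totikRadius),
          totikMeasure_compl_totikSet, add_zero]

theorem support_totikMeasure : (totikMeasure totikRadius).support = unitSegment := by
  refine subset_antisymm (Measure.support_subset_of_isClosed isClosed_unitSegment ?_) ?_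
  · exact measure_mono_null (compl_subset_compl.2 totikSet_subset_unitSegment)
      (totikMeasure_compl_totikSet _)
  rintro _ ⟨x, hx, rfl⟩
  rw [Measure.mem_support_iff_forall]
  intro U hU
  obtain ⟨δ, hδ, hball⟩ := Metric.mem_nhds_iff.1 hU
  obtain ⟨m, hm⟩ := exists_nat_gt (2 / δ)
  set n := m + 2 with hn
  have hn1 : (1 : ℝ) ≤ n := by exact_mod_cast (by omega : 1 ≤ n)
  have hnδ : 2 / (n : ℝ) ^ 3 < δ := by
    rw [div_lt_iff₀ hδ] at hm
    rw [div_lt_iff₀ (by positivity)]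
    have h1 : (m : ℝ) ≤ n := by exact_mod_cast (by omega : m ≤ n)
    have h2 : (n : ℝ) ≤ (n : ℝ) ^ 3 := le_self_pow₀ hn1 (by norm_num)
    nlinarith
  obtain ⟨k, hk, hkx⟩ := exists_mesh_near (n := n) (by omega) hx
  refine lt_of_lt_of_le ?_ (le_totikMeasure (fun n _ => totikRadius_pos n) hk fun y hy => hball ?_)
  · exact ENNReal.ofReal_pos.2 (by positivity)
  · rw [Metric.mem_ball, Complex.dist_eq, ← Complex.ofReal_sub, Complex.norm_real,
      Real.norm_eq_abs]
    have h1 := totikRadius_le (n := n) (by omega)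
    have h2 := abs_le.1 hkx
    have h3 : 1 / (n : ℝ) ^ 3 + 1 / (n : ℝ) ^ 3 = 2 / (n : ℝ) ^ 3 := by ring
    refine lt_of_le_of_lt (abs_le.2 ?_) hnδ
    constructor <;> linarith [hy.1, hy.2, h2.1, h2.2]

/-- A polynomial of degree at most `m` is at least half of its maximum on some interval of
generation `m + 16`, whose mass decays only polynomially in `m`. -/
theorem iSup_enorm_eval_le {m : ℕ} {p : Polynomial ℂ} (hp : p.natDegree ≤ m) :
    (⨆ z ∈ unitSegment, ‖p.eval z‖ₑ) ≤ ENNReal.ofReal (2 * ((m + 16 : ℕ) : ℝ) ^ 3) *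
      eLpNorm (fun z => p.eval z) 2 (totikMeasure totikRadius) := by
  obtain ⟨x₀, hx₀, hmax⟩ := isCompact_Icc.exists_isMaxOn (s := Icc (0 : ℝ) 1) ⟨0, by simp⟩
    (f := fun x : ℝ => ‖p.eval (x : ℂ)‖)
    (Continuous.continuousOn (p.continuous.comp Complex.continuous_ofReal).norm)
  set M := ‖p.eval (x₀ : ℂ)‖ with hM
  have hM0 : 0 ≤ M := norm_nonneg _
  have hsup : (⨆ z ∈ unitSegment, ‖p.eval z‖ₑ) ≤ ENNReal.ofReal M := by
    refine iSup₂_le ?_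
    rintro _ ⟨x, hx, rfl⟩
    rw [← ofReal_norm]
    exact ENNReal.ofReal_le_ofReal (hmax hx)
  refine hsup.trans ?_
  set n := m + 16 with hn
  have hn16 : (16 : ℝ) ≤ n := by exact_mod_cast (by omega : 16 ≤ n)
  have hmn : (m : ℝ) ≤ n := by exact_mod_cast (by omega : m ≤ n)
  obtain ⟨k, hk, hkx⟩ := exists_mesh_near (n := n) (by omega) hx₀
  have hε := totikRadius_le (n := n) (by omega)
  have hmass : ENNReal.ofReal (2 / (n : ℝ) ^ 5) ≤
      totikMeasure totikRadius {z | ENNReal.ofReal (M / 2) ≤ ‖p.eval z‖ₑ} := by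
    refine le_totikMeasure (fun n _ => totikRadius_pos n) hk fun x hx => ?_
    rw [mem_ofPred_eq, ← ofReal_norm]
    refine ENNReal.ofReal_le_ofReal
      (norm_eval_ge_near_max hp hx₀ (fun y hy => hmax hy) (smallInterval_subset_Icc hε hk hx) ?_)
    have h2 := abs_le.1 hkx
    have h3 : |x - x₀| ≤ 2 / (n : ℝ) ^ 3 := by
      have h4 : 1 / (n : ℝ) ^ 3 + 1 / (n : ℝ) ^ 3 = 2 / (n : ℝ) ^ 3 := by ring
      refine abs_le.2 ?_
      constructor <;> linarith [hx.1, hx.2, h2.1, h2.2]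
    calc 8 * (m : ℝ) ^ 2 * |x - x₀| ≤ 8 * (n : ℝ) ^ 2 * (2 / (n : ℝ) ^ 3) := by gcongr
      _ = 16 / (n : ℝ) := by field_simp; norm_num
      _ ≤ 1 := (div_le_one (by linarith)).2 hn16
  have hcheb := mul_meas_ge_le_pow_eLpNorm' (p := 2) (totikMeasure totikRadius) (by norm_num)
    (by norm_num) (f := fun z => p.eval z) p.continuous.aestronglyMeasurable
    (ENNReal.ofReal (M / 2))
  simp only [ENNReal.toReal_ofNat, ENNReal.rpow_ofNat] at hcheb
  rw [← ENNReal.pow_le_pow_left_iff two_ne_zero, mul_pow]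
  calc ENNReal.ofReal M ^ 2
      ≤ ENNReal.ofReal (2 * (n : ℝ) ^ 3) ^ 2 *
          (ENNReal.ofReal (M / 2) ^ 2 * ENNReal.ofReal (2 / (n : ℝ) ^ 5)) := by
        rw [← ENNReal.ofReal_pow hM0, ← ENNReal.ofReal_pow (by positivity),
          ← ENNReal.ofReal_pow (by positivity), ← ENNReal.ofReal_mul (by positivity),
          ← ENNReal.ofReal_mul (by positivity)]
        refine ENNReal.ofReal_le_ofReal ?_
        have : (2 * (n : ℝ) ^ 3) ^ 2 * ((M / 2) ^ 2 * (2 / (n : ℝ) ^ 5)) = 2 * n * M ^ 2 := by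
          field_simp
        rw [this]
        nlinarith [sq_nonneg M]
    _ ≤ _ := by gcongr; exact (mul_le_mul_right hmass _).trans hcheb

theorem polynomialBM_totikMeasure : PolynomialBM unitSegment (totikMeasure totikRadius) := by
  intro η hη
  -- Since `k + 16 ≤ 17 k` for `k ≥ 1`, the constant is polynomial in `k`.
  have htend : Tendsto (fun k : ℕ => 2 * 17 ^ 3 * ((k : ℝ) ^ 3 / (1 + η) ^ k)) atTop (𝓝 _) :=
    (tendsto_pow_const_div_const_pow_of_one_lt 3 (by linarith : (1 : ℝ) < 1 + η)).const_mul _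
  obtain ⟨C, hC⟩ := htend.bddAbove_range
  refine ⟨C, fun k hk p hp => (iSup_enorm_eval_le hp).trans ?_⟩
  refine mul_le_mul_left (ENNReal.ofReal_le_ofReal ?_) _
  have h1 : 2 * 17 ^ 3 * ((k : ℝ) ^ 3 / (1 + η) ^ k) ≤ C := hC ⟨k, rfl⟩
  have h2 : (0 : ℝ) < (1 + η) ^ k := by positivity
  rw [← mul_div_assoc, div_le_iff₀ h2] at h1
  refine le_trans ?_ h1
  have h3 : ((k + 16 : ℕ) : ℝ) ≤ 17 * k := by exact_mod_cast (by omega : k + 16 ≤ 17 * k)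
  calc 2 * ((k + 16 : ℕ) : ℝ) ^ 3 ≤ 2 * (17 * (k : ℝ)) ^ 3 := by gcongr
    _ = _ := by ring

theorem norm_meshPoint_le (j : ℕ) : ‖(meshPoint j : ℂ)‖ ≤ 1 :=
  norm_le_one_of_mem_Icc (meshPoint_mem_Icc j)

theorem atomicPotential_meshPoint_nonpos {z : ℂ} (hz : z ∈ totikSet totikRadius) :
    atomicPotential (fun j => (meshPoint j : ℂ)) 4 z ≤ 0 := by
  obtain ⟨j, hj⟩ := exists_norm_sub_meshPoint_le hz
  refine atomicPotential_nonpos (by norm_num) (fun i => ?_) (hj.trans ?_)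
  · have h1 := edist_le_one_of_mem_unitSegment (totikSet_subset_unitSegment hz)
      (⟨_, meshPoint_mem_Icc i, rfl⟩ : (meshPoint i : ℂ) ∈ unitSegment)
    rw [edist_dist, ENNReal.ofReal_le_one, dist_eq_norm] at h1
    exact h1
  · refine Real.exp_le_exp.2 (neg_le_neg ?_)
    have h2 : (2 : ℝ) ^ (j + 1) ≤ 4 ^ (j + 1) := by gcongr; norm_num
    have h3 : (4 : ℝ) ^ (j + 4) = 4 ^ (j + 1) * 64 := by ring
    have h4 : (0 : ℝ) < 4 ^ (j + 1) := by positivity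
    linarith

/-- The constant `4` in the potential exceeds the Bernstein–Walsh bound at the point `2`. -/
theorem log_three_add_two_lt_four : Real.log (1 + ‖(2 : ℂ)‖) + 2 < 4 := by
  have h1 : Real.log (1 + ‖(2 : ℂ)‖) ≤ Real.log (2 ^ 2) := by
    rw [Complex.norm_ofNat]
    exact Real.log_le_log (by norm_num) (by norm_num)
  rw [Real.log_pow] at h1
  have := Real.log_two_lt_d9
  push_cast at h1
  linarith

theorem atomicPotential_meshPoint_mem :
    atomicPotential (fun j => (meshPoint j : ℂ)) 4 ∈ lelongClass :=
  atomicPotential_mem_lelongClass norm_meshPoint_le (by norm_num)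

theorem not_isDetermining_totikMeasure :
    ¬ IsDetermining unitSegment (totikMeasure totikRadius) := by
  intro h
  have h1 := congrFun (h _ isCarrier_totikSet) 2
  have h2 : (4 : EReal) ≤ extremalFunReg (totikSet totikRadius) 2 :=
    calc (4 : EReal) ≤ atomicPotential (fun j => (meshPoint j : ℂ)) 4 2 :=
          le_atomicPotential_two norm_meshPoint_le 4
      _ ≤ extremalFun (totikSet totikRadius) 2 :=
          le_iSup₂_of_le _ ⟨atomicPotential_meshPoint_mem,
            fun _ hw => atomicPotential_meshPoint_nonpos hw⟩ le_rfl
      _ ≤ extremalFunReg (totikSet totikRadius) 2 :=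
          le_limsup_of_frequently_le' fun hev => hev.self_of_nhds le_rfl
  rw [h1] at h2
  have h3 := h2.trans (extremalFunReg_unitSegment_le 2)
  exact absurd (EReal.coe_le_coe_iff.1 h3) (not_le.2 log_three_add_two_lt_four)

/-- A function of the class `L(ℂ)` that is nonpositive on the carrier but positive somewhere on
`[0, 1]` has bounded integrals `∫ e^{pu} dμ`, whereas `(sup e^u)^p` grows exponentially. -/
theorem not_subharmonicBM_totikMeasure :
    ¬ SubharmonicBM unitSegment (totikMeasure totikRadius) := by
  intro h
  set u := atomicPotential (fun j => (meshPoint j : ℂ)) 4 with hu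
  obtain ⟨w, hw, hpos⟩ : ∃ w ∈ unitSegment, 0 < u w := by
    by_contra! hcon
    have h1 := (le_atomicPotential_two norm_meshPoint_le 4).trans
      (le_log_one_add_norm_of_mem_lelongClass atomicPotential_meshPoint_mem hcon 2)
    exact absurd (EReal.coe_le_coe_iff.1 h1) (not_le.2 log_three_add_two_lt_four)
  obtain ⟨s, hs0, hsu⟩ := EReal.lt_iff_exists_real_btwn.1 hpos
  have hs0 : 0 < s := by exact_mod_cast hs0
  obtain ⟨C, hC⟩ := h (Real.exp (s / 2) - 1) (by linarith [Real.add_one_lt_exp (half_pos hs0).ne'])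
  have := isFiniteMeasure_totikMeasure (fun n _ => totikRadius_pos n)
  set m := totikMeasure totikRadius univ with hm
  have hmtop : m ≠ ⊤ := measure_ne_top _ _
  have key : ∀ p : ℝ, 1 ≤ p → Real.exp (s * p / 2) ≤ |C| * m.toReal := by
    intro p hp
    have hp0 : 0 ≤ p := by linarith
    have hint : ∫⁻ z, EReal.exp (u z) ^ p ∂totikMeasure totikRadius ≤ m := by
      calc _ ≤ ∫⁻ _, 1 ∂totikMeasure totikRadius := by
            refine lintegral_mono_ae ?_
            filter_upwards [mem_ae_iff.2 (totikMeasure_compl_totikSet totikRadius)] with z hz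
            exact ENNReal.rpow_le_one (EReal.exp_le_one_iff.2 (atomicPotential_meshPoint_nonpos hz))
              hp0
        _ = m := lintegral_one
    have h1 : ENNReal.ofReal (Real.exp (s * p)) ≤
        ENNReal.ofReal (|C| * Real.exp (s * p / 2)) * m :=
      calc ENNReal.ofReal (Real.exp (s * p)) = EReal.exp (s : EReal) ^ p := by
            rw [EReal.exp_coe, ENNReal.ofReal_rpow_of_pos (Real.exp_pos s), ← Real.exp_mul]
        _ ≤ (⨆ z ∈ unitSegment, EReal.exp (u z)) ^ p :=
            ENNReal.rpow_le_rpow ((EReal.exp_monotone hsu.le).trans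
              (le_iSup₂_of_le w hw le_rfl)) hp0
        _ ≤ _ := hC p hp u atomicPotential_meshPoint_mem
        _ ≤ _ := by
            rw [add_sub_cancel, ← Real.exp_mul, div_mul_eq_mul_div]
            gcongr
            exact le_abs_self C
    have h2 := ENNReal.toReal_mono (by finiteness) h1
    rw [ENNReal.toReal_mul, ENNReal.toReal_ofReal (Real.exp_pos _).le,
      ENNReal.toReal_ofReal (by positivity)] at h2
    have h3 : Real.exp (s * p) = Real.exp (s * p / 2) * Real.exp (s * p / 2) := by
      rw [← Real.exp_add, add_halves]
    rw [h3] at h2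
    have h4 := Real.exp_pos (s * p / 2)
    refine le_of_mul_le_mul_right ?_ h4
    linarith
  have hnn : 0 ≤ |C| * m.toReal := by positivity
  have h5 := key (1 + 2 * (|C| * m.toReal) / s) (by
    have : 0 ≤ 2 * (|C| * m.toReal) / s := by positivity
    linarith)
  have h6 : s * (1 + 2 * (|C| * m.toReal) / s) / 2 = s / 2 + |C| * m.toReal := by field_simp
  rw [h6] at h5
  linarith [Real.add_one_le_exp (s / 2 + |C| * m.toReal)]

end BernsteinMarkov

end

theorem mainTheorem7 :
    ∃ ε : ℕ → ℝ, (∀ n : ℕ, 1 ≤ n → 0 < ε n) ∧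
      BernsteinMarkov.logCapacity (BernsteinMarkov.totikSet ε) < 1 / 8 ∧
      IsFiniteMeasure (BernsteinMarkov.totikMeasure ε) ∧
      (BernsteinMarkov.totikMeasure ε).support = BernsteinMarkov.unitSegment ∧
      BernsteinMarkov.IsCarrier BernsteinMarkov.unitSegment (BernsteinMarkov.totikMeasure ε)
        (BernsteinMarkov.totikSet ε) ∧
      (∀ F : Set ℂ, BernsteinMarkov.IsPolar F → BernsteinMarkov.totikMeasure ε F = 0) ∧
      BernsteinMarkov.PolynomialBM BernsteinMarkov.unitSegment (BernsteinMarkov.totikMeasure ε) ∧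
      ¬ BernsteinMarkov.IsDetermining BernsteinMarkov.unitSegment
        (BernsteinMarkov.totikMeasure ε) ∧
      ¬ BernsteinMarkov.SubharmonicBM BernsteinMarkov.unitSegment
        (BernsteinMarkov.totikMeasure ε) :=
  ⟨BernsteinMarkov.totikRadius, fun n _ => BernsteinMarkov.totikRadius_pos n,
    BernsteinMarkov.logCapacity_totikSet_lt,
    BernsteinMarkov.isFiniteMeasure_totikMeasure fun n _ => BernsteinMarkov.totikRadius_pos n,
    BernsteinMarkov.support_totikMeasure, BernsteinMarkov.isCarrier_totikSet,
    fun _ hF => BernsteinMarkov.totikMeasure_eq_zero_of_volume hF.volume_preimage_ofReal,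
    BernsteinMarkov.polynomialBM_totikMeasure, BernsteinMarkov.not_isDetermining_totikMeasure,
    BernsteinMarkov.not_subharmonicBM_totikMeasure⟩
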